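/- **Setting.** Let $\Theta\subset\mathbb R^d$, $\Phi\subset\mathbb R^{p}$ and $\Psi:\Theta\times\Phi\to\mathbb R^k$. For $\phi\in\Phi$ and $\nu$ in the unit sphere $\mathbb S^d$ of $\mathbb R^d$ put $$\Theta(\phi)=\{\theta\in\Theta:\Psi(\theta,\phi)\le 0\},\quad S_\phi(\nu)=\sup_{\theta\in\Theta(\phi)}\nu^T\theta,\quad \Xi(\nu,\phi)=\arg\max_{\theta\in\Theta(\phi)}\nu^T\theta,$$ $Act(\theta,\phi)=\{i:\Psi_i(\theta,\phi)=0\}$ and $B(\phi_0,\delta)=\{\phi\in\Phi:\|\phi-\phi_0\|\le\delta\}$. For $A\subset\Theta$ let $A^\varepsilon=\{\theta\in\Theta:d(\theta,A)\le\varepsilon\}$. Let $r_n=\sqrt{(\log n)/n}$. The data $X_1,X_2,\dots$ are i.i.d. with law $P_{h_0}$, where $(P_h)_{h\in H}$ is a statistical model with a measurable finite-dimensional parameter $\phi=\phi(h)\in\Phi$; $\phi_0=\phi(h_0)$ and $D_n=(X_1,\dots,X_n)$. A prior on $H$ is given, and $P(\cdot\mid D_n)$ denotes (a version of) the posterior given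 $D_n$; the posteriors of $\phi$ and of $S_\phi(\nu)$ are its images. Let $l_{\phi_0}$ and $I_0$ be the semiparametric efficient score function and the nonsingular efficient information matrix for $\phi$ at $h_0$, relative to a collection of one-dimensional submodels differentiable in quadratic mean: the components of $l_{\phi_0}$ lie in the closed linear span in $L^2(P_{h_0})$ of the scores $g$ of the submodels, $I_0=\int l_{\phi_0}l_{\phi_0}^T\,dP_{h_0}$, and along every submodel with score $g$ the parameter $\phi$ has derivative $\int I_0^{-1}l_{\phi_0}\,g\,dP_{h_0}$. Put $\Delta_n=n^{-1/2}\sum_{i=1}^n I_0^{-1}l_{\phi_0}(X_i)$, and $\|P-Q\|_{TV}=\sup_B|P(B)-Q(B)|$. **Assumptions.** 1. $\Psi$ is continuous on $\Theta\times\Phi$ and each $\Psi_i(\cdot,\phi)$ is convex on $\Theta$ for $\phi\in\Phi$; $\phi_0$ is interior to $\Phi$; $\Theta$ is convex and compact; for every $\theta\in\Theta(\phi_0)$ the gradients $\nabla_\theta\Psi_i(\theta,\phi_0)$, $i\in Act(\theta,\phi_0)$, are linearly independent. 2. For all large $n$, with $\delta=r_n$: $\nabla_\phi\Psi$ (a $k\times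 p$ matrix) exists and is continuous on $\Theta\times B(\phi_0,\delta)$; for $\phi\in B(\phi_0,\delta)$ the set $\Theta(\phi)$ is nonempty and contained in the interior of $\Theta$, and $\Psi(\theta,\phi)<0$ for some $\theta\in\Theta$; if $i\in Act(\theta_0,\phi_0)$ for some $\theta_0\in\Theta(\phi_0)$, then $\nabla_\theta\Psi_i(\theta,\phi)$ exists and is continuous in $(\theta,\phi)$ for $\phi\in B(\phi_0,\delta)$, $\theta\in\Theta(\phi)$. 3. For all large $n$, with $\delta=r_n$, at least one of the following holds: (a) $\Xi(\nu,\phi)$ is a singleton for all $(\nu,\phi)\in\mathbb S^d\times B(\phi_0,\delta)$; (b) the constraints split into those with $\Psi_i(\cdot,\phi_0)$ strictly convex on $\Theta$ and a nonempty group $\Psi_L$ of linear separable ones, $\Psi_L(\theta,\phi)=A_1\theta+A_2(\phi)$ for $\theta\in\Theta$, $\phi\in B(\phi_0,\delta)$. 4. $\lambda(\nu,\phi)\in\mathbb R_+^k$ is, for all large $n$ and all $(\nu,\phi)\in\mathbb S^d\times B(\phi_0,r_n)$, a vector of Lagrange multipliers: $S_\phi(\nu)=\sup_{\theta\in\Theta}\{\nu^T\theta-\lambda(\nu,\phi)^T\Psi(\theta,\phi)\}$.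 5. There is $K>0$ such that for all large $n$ and all $\phi_1,\phi_2\in B(\phi_0,r_n)$: $\sup_{\nu}\|\lambda(\nu,\phi_1)-\lambda(\nu,\phi_2)\|\le K\|\phi_1-\phi_2\|$; $\sup_{\theta\in\Theta}\|\nabla_\phi\Psi(\theta,\phi_1)-\nabla_\phi\Psi(\theta,\phi_2)\|\le K\|\phi_1-\phi_2\|$; and $\|\nabla_\phi\Psi(\theta_1,\phi_0)-\nabla_\phi\Psi(\theta_2,\phi_0)\|\le K\|\theta_1-\theta_2\|$ for $\theta_1,\theta_2\in\Theta$ (Frobenius norms). Moreover, for every compact $W\subset\mathbb S^d$ such that $\Xi(\nu,\phi_0)$ is a singleton for all $\nu\in W$, there are $\varepsilon_n=O(r_n)$ such that, for all large $n$, if $\Xi$ is upper hemicontinuous on $\mathbb S^d\times B(\phi_0,r_n)$, then $\Xi(\nu,\phi_1)\subset\Xi(\nu,\phi_0)^{\varepsilon_n}$ for all $\nu\in W$, $\phi_1\in B(\phi_0,r_n)$. 6. For some $C>0$, $P(\|\phi-\phi_0\|\le C\,r_n\mid D_n)\to1$ in probability. 7. $\big\|P_{\sqrt n(\phi-\phi_0)\mid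 D_n}-\mathcal N(\Delta_n,I_0^{-1})\big\|_{TV}\to0$ in probability. **Theorem (Bernstein–von Mises for the support function).** Under these assumptions, let $\theta_*(\nu)\in\Xi(\nu,\phi_0)$ for $\nu\in\mathbb S^d$ be any selection, and put $$\bar\Delta_n(\nu)=-\lambda(\nu,\phi_0)^T\nabla_\phi\Psi(\theta_*(\nu),\phi_0)\,\Delta_n,$$ $$\bar I_0^{-1}(\nu)=\lambda(\nu,\phi_0)^T\nabla_\phi\Psi(\theta_*(\nu),\phi_0)\,I_0^{-1}\,\nabla_\phi\Psi(\theta_*(\nu),\phi_0)^T\lambda(\nu,\phi_0).$$ Then for every $\nu\in\mathbb S^d$ with $\bar I_0^{-1}(\nu)>0$, $$\big\|P_{\sqrt n(S_\phi(\nu)-S_{\phi_0}(\nu))\mid D_n}-\mathcal N\big(\bar\Delta_n(\nu),\bar I_0^{-1}(\nu)\big)\big\|_{TV}\to0\quad\text{in probability.}$$ -/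

import Mathlib

open MeasureTheory ProbabilityTheory Filter Topology

noncomputable section

/-- Euclidean space `ℝⁿ`. -/
abbrev Euc (n : ℕ) : Type := EuclideanSpace ℝ (Fin n)

/-! ### The moment inequality model -/

section Model

variable {d p k : ℕ}

/-- The identified set `Θ(φ) = {θ ∈ Θ : Ψ(θ, φ) ≤ 0}`. -/
def identifiedSet (Θ : Set (Euc d)) (Ψ : Euc d → Euc p → Euc k) (φ : Euc p) : Set (Euc d) :=
  {θ | θ ∈ Θ ∧ ∀ i, Ψ θ φ i ≤ 0}

/-- The support function `S_φ(ν) = sup {νᵀθ : θ ∈ Θ(φ)}`. -/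
def supportFun (Θ : Set (Euc d)) (Ψ : Euc d → Euc p → Euc k) (φ : Euc p) (ν : Euc d) : ℝ :=
  sSup ((fun θ => inner ℝ ν θ) '' identifiedSet Θ Ψ φ)

/-- The support set `Ξ(ν, φ) = argmax {νᵀθ : θ ∈ Θ(φ)}`. -/
def supportSet (Θ : Set (Euc d)) (Ψ : Euc d → Euc p → Euc k) (ν : Euc d) (φ : Euc p) :
    Set (Euc d) :=
  {θ | θ ∈ identifiedSet Θ Ψ φ ∧ ∀ θ' ∈ identifiedSet Θ Ψ φ, inner ℝ ν θ' ≤ inner ℝ ν θ}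

/-- The set `Act(θ, φ)` of the indices of the active constraints. -/
def activeSet (Ψ : Euc d → Euc p → Euc k) (θ : Euc d) (φ : Euc p) : Set (Fin k) :=
  {i | Ψ θ φ i = 0}

/-- The ball `B(φ₀, δ) = {φ ∈ Φ : ‖φ - φ₀‖ ≤ δ}`. -/
def paramBall (Φ : Set (Euc p)) (φ₀ : Euc p) (δ : ℝ) : Set (Euc p) :=
  {φ | φ ∈ Φ ∧ ‖φ - φ₀‖ ≤ δ}

/-- The `k × p` matrix `∇_φ Ψ(θ, φ)` of partial derivatives with respect to `φ`. -/
def jacParam (Ψ : Euc d → Euc p → Euc k) (θ : Euc d) (φ : Euc p) : Matrix (Fin k) (Fin p) ℝ :=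
  Matrix.of fun i j => (fderiv ℝ (fun φ' => Ψ θ φ') φ (EuclideanSpace.single j 1)) i

/-- The gradient `∇_θ Ψ_i(θ, φ)` with respect to `θ`. -/
def gradTheta (Ψ : Euc d → Euc p → Euc k) (i : Fin k) (θ : Euc d) (φ : Euc p) : Euc d :=
  gradient (fun θ' => Ψ θ' φ i) θ

/-- The Frobenius norm of a real matrix. -/
def frobNorm {m n : ℕ} (A : Matrix (Fin m) (Fin n) ℝ) : ℝ :=
  √(∑ i, ∑ j, A i j ^ 2)

/-- The envelope `A^ε = {θ ∈ Θ : d(θ, A) ≤ ε}`. -/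
def envelope (Θ A : Set (Euc d)) (ε : ℝ) : Set (Euc d) :=
  {θ | θ ∈ Θ ∧ Metric.infDist θ A ≤ ε}

/-- `l ∈ ℝ₊ᵏ` is a vector of Lagrange multipliers of the program defining `S_φ(ν)`:
`S_φ(ν) = sup {νᵀθ - lᵀΨ(θ, φ) : θ ∈ Θ}`. -/
def IsLagrangeMultiplier (Θ : Set (Euc d)) (Ψ : Euc d → Euc p → Euc k) (ν : Euc d) (φ : Euc p)
    (l : Euc k) : Prop :=
  (∀ i, 0 ≤ l i) ∧
    IsLUB ((fun θ => inner ℝ ν θ - inner ℝ l (Ψ θ φ)) '' Θ) (supportFun Θ Ψ φ ν)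

/-- Global conditions on the model: continuity, convexity, compactness, interior true value, and
linear independence of the gradients of the active constraints at the true value. -/
structure BasicConditions (Θ : Set (Euc d)) (Φ : Set (Euc p)) (Ψ : Euc d → Euc p → Euc k)
    (φ₀ : Euc p) : Prop where
  continuousOn : ContinuousOn (fun q : Euc d × Euc p => Ψ q.1 q.2) (Θ ×ˢ Φ)
  convexOn : ∀ φ ∈ Φ, ∀ i, ConvexOn ℝ Θ (fun θ => Ψ θ φ i)
  mem_interior : φ₀ ∈ interior Φ
  convex : Convex ℝ Θ
  isCompact : IsCompact Θ
  linearIndependent : ∀ θ ∈ identifiedSet Θ Ψ φ₀,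
    LinearIndependent ℝ (fun i : activeSet Ψ θ φ₀ => gradTheta Ψ i θ φ₀)

/-- Regularity of the model on `B(φ₀, δ)`. -/
structure LocalRegularity (Θ : Set (Euc d)) (Φ : Set (Euc p)) (Ψ : Euc d → Euc p → Euc k)
    (φ₀ : Euc p) (δ : ℝ) : Prop where
  differentiableAt : ∀ θ ∈ Θ, ∀ φ ∈ paramBall Φ φ₀ δ, DifferentiableAt ℝ (fun φ' => Ψ θ φ') φ
  continuousOn_jac :
    ContinuousOn (fun q : Euc d × Euc p => jacParam Ψ q.1 q.2) (Θ ×ˢ paramBall Φ φ₀ δ)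
  nonempty : ∀ φ ∈ paramBall Φ φ₀ δ, (identifiedSet Θ Ψ φ).Nonempty
  slater : ∀ φ ∈ paramBall Φ φ₀ δ, ∃ θ ∈ Θ, ∀ i, Ψ θ φ i < 0
  subset_interior : ∀ φ ∈ paramBall Φ φ₀ δ, identifiedSet Θ Ψ φ ⊆ interior Θ
  differentiableAt_theta : ∀ θ₀ ∈ identifiedSet Θ Ψ φ₀, ∀ i ∈ activeSet Ψ θ₀ φ₀,
    ∀ φ ∈ paramBall Φ φ₀ δ, ∀ θ ∈ identifiedSet Θ Ψ φ, DifferentiableAt ℝ (fun θ' => Ψ θ' φ i) θ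
  continuousOn_grad : ∀ θ₀ ∈ identifiedSet Θ Ψ φ₀, ∀ i ∈ activeSet Ψ θ₀ φ₀,
    ContinuousOn (fun q : Euc d × Euc p => gradTheta Ψ i q.1 q.2)
      {q | q.2 ∈ paramBall Φ φ₀ δ ∧ q.1 ∈ identifiedSet Θ Ψ q.2}

/-- For every direction and every `φ ∈ B(φ₀, δ)` the support set is a singleton. -/
def SingletonSupport (Θ : Set (Euc d)) (Φ : Set (Euc p)) (Ψ : Euc d → Euc p → Euc k)
    (φ₀ : Euc p) (δ : ℝ) : Prop :=
  ∀ ν ∈ Metric.sphere (0 : Euc d) 1, ∀ φ ∈ paramBall Φ φ₀ δ, ∃ θ, supportSet Θ Ψ ν φ = {θ}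

/-- Each constraint is strictly convex in `θ` at `φ₀` or linear in `θ`, there are linear ones
(indexed by `L`), and they are separable: `Ψ_L(θ, φ) = A₁ θ + A₂(φ)`. -/
def SeparableLinear (Θ : Set (Euc d)) (Φ : Set (Euc p)) (Ψ : Euc d → Euc p → Euc k)
    (φ₀ : Euc p) (δ : ℝ) : Prop :=
  ∃ L : Set (Fin k), L.Nonempty ∧
    (∀ i, i ∉ L → StrictConvexOn ℝ Θ (fun θ => Ψ θ φ₀ i)) ∧
    ∃ (A₁ : L → Euc d) (A₂ : Euc p → L → ℝ),
      ∀ i : L, ∀ θ ∈ Θ, ∀ φ ∈ paramBall Φ φ₀ δ, Ψ θ φ i = inner ℝ (A₁ i) θ + A₂ φ i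

/-- Lipschitz conditions, with constant `K`, on `B(φ₀, δ)`. -/
structure LipschitzConditions (Θ : Set (Euc d)) (Φ : Set (Euc p)) (Ψ : Euc d → Euc p → Euc k)
    (φ₀ : Euc p) (lam : Euc d → Euc p → Euc k) (K δ : ℝ) : Prop where
  multiplier : ∀ φ₁ ∈ paramBall Φ φ₀ δ, ∀ φ₂ ∈ paramBall Φ φ₀ δ,
    ∀ ν ∈ Metric.sphere (0 : Euc d) 1, ‖lam ν φ₁ - lam ν φ₂‖ ≤ K * ‖φ₁ - φ₂‖
  jac_param : ∀ φ₁ ∈ paramBall Φ φ₀ δ, ∀ φ₂ ∈ paramBall Φ φ₀ δ,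
    ∀ θ ∈ Θ, frobNorm (jacParam Ψ θ φ₁ - jacParam Ψ θ φ₂) ≤ K * ‖φ₁ - φ₂‖
  jac_theta : ∀ θ₁ ∈ Θ, ∀ θ₂ ∈ Θ,
    frobNorm (jacParam Ψ θ₁ φ₀ - jacParam Ψ θ₂ φ₀) ≤ K * ‖θ₁ - θ₂‖

/-- For radii `r n`, `n ≥ N`: if `Ξ(ν, φ₀)` is a singleton for all `ν` in a compact `W ⊆ 𝕊` then,
for some `ε n = O(r n)`, whenever `Ξ` is upper hemicontinuous on `𝕊 × B(φ₀, r n)` one has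
`Ξ(ν, φ₁) ⊆ Ξ(ν, φ₀)^(ε n)` for `ν ∈ W` and `φ₁ ∈ B(φ₀, r n)`. -/
def SupportSetCondition (Θ : Set (Euc d)) (Φ : Set (Euc p)) (Ψ : Euc d → Euc p → Euc k)
    (φ₀ : Euc p) (r : ℕ → ℝ) (N : ℕ) : Prop :=
  ∀ W ⊆ Metric.sphere (0 : Euc d) 1, IsCompact W → (∀ ν ∈ W, ∃ θ, supportSet Θ Ψ ν φ₀ = {θ}) →
    ∃ ε : ℕ → ℝ, ε =O[atTop] r ∧ ∀ n ≥ N,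
      UpperHemicontinuousOn (fun q : Euc d × Euc p => supportSet Θ Ψ q.1 q.2)
        (Metric.sphere (0 : Euc d) 1 ×ˢ paramBall Φ φ₀ (r n)) →
      ∀ ν ∈ W, ∀ φ₁ ∈ paramBall Φ φ₀ (r n),
        supportSet Θ Ψ ν φ₁ ⊆ envelope Θ (supportSet Θ Ψ ν φ₀) (ε n)

end Model

/-- The rate `r_n = √(log n / n)`. -/
def rate (n : ℕ) : ℝ := √(Real.log n / n)

/-- The total variation distance `sup_B |P(B) - Q(B)|`. -/
def tvDist {α : Type*} [MeasurableSpace α] (P Q : Measure α) : ℝ :=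
  ⨆ B : {B : Set α // MeasurableSet B}, |P.real B - Q.real B|

/-! ### Sampling and posteriors -/

section Bayes

variable {H 𝒳 : Type*} [MeasurableSpace H] [MeasurableSpace 𝒳]

/-- The law of `n` i.i.d. observations from `P h`, as a kernel in the parameter `h`. -/
def sampleKernel (P : Kernel H 𝒳) [IsMarkovKernel P] (n : ℕ) : Kernel H (Fin n → 𝒳) where
  toFun h := Measure.pi fun _ => P h
  measurable' := by
    refine Measurable.measure_of_isPiSystem_of_isProbabilityMeasure
      (generateFrom_pi (α := fun _ : Fin n => 𝒳)).symm isPiSystem_pi ?_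
    rintro _ ⟨t, ht, rfl⟩
    simp only [Measure.pi_pi]
    exact Finset.measurable_prod _ fun i _ => P.measurable_coe (ht i (Set.mem_univ i))

/-- `κ` is a (version of the) posterior distribution of the parameter given `n` i.i.d.
observations from `P h`, under the prior `pr`: the joint law of parameter and data is the marginal
law of the data followed by `κ`. -/
def IsPosterior (pr : Measure H) (P : Kernel H 𝒳) [IsMarkovKernel P] (n : ℕ)
    (κ : Kernel (Fin n → 𝒳) H) : Prop :=
  IsMarkovKernel κ ∧
    (pr.bind (sampleKernel P n)) ⊗ₘ κ = (pr ⊗ₘ sampleKernel P n).map Prod.swap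

/-- `g ∈ L²₀(P_{γ 0})` is the score at `t = 0` of the one-dimensional submodel `t ↦ P_{γ t}`,
`t ≥ 0`, which is differentiable in quadratic mean:
`∫ ((√dP_{γ t} - √dP_{γ 0}) / t - g √dP_{γ 0} / 2)² → 0` as `t ↓ 0`. -/
structure IsScore (P : Kernel H 𝒳) (γ : ℝ → H) (g : 𝒳 → ℝ) : Prop where
  memLp : MemLp g 2 (P (γ 0))
  integral_eq_zero : ∫ x, g x ∂(P (γ 0)) = 0
  tendsto : Tendsto (fun t : ℝ => ∫⁻ x, ENNReal.ofReal
      (((√((P (γ t)).rnDeriv (P (γ t) + P (γ 0)) x).toReal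
          - √((P (γ 0)).rnDeriv (P (γ t) + P (γ 0)) x).toReal) / t
        - g x * √((P (γ 0)).rnDeriv (P (γ t) + P (γ 0)) x).toReal / 2) ^ 2)
      ∂(P (γ t) + P (γ 0))) (𝓝[>] 0) (𝓝 0)

/-- The tangent set at `h₀` generated by a collection `T` of submodels. -/
def tangentSet (P : Kernel H 𝒳) (T : Set (ℝ → H)) (h₀ : H) : Set (𝒳 → ℝ) :=
  {g | ∃ γ ∈ T, γ 0 = h₀ ∧ IsScore P γ g}

/-- `l` and `I₀` are the efficient score function and the (nonsingular) efficient information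
matrix at `h₀`, relative to the submodels `T`, for the finite-dimensional parameter `phi`:
the components of `l` lie in the closed linear span in `L²` of the tangent set, `I₀` is the
covariance matrix of `l`, and `I₀⁻¹ l` is the influence function, that is, along each submodel
with score `g` the derivative of `phi` is `∫ I₀⁻¹ l g`. -/
structure IsEfficientScore {p : ℕ} (P : Kernel H 𝒳) (phi : H → Euc p) (T : Set (ℝ → H))
    (h₀ : H) (l : 𝒳 → Euc p) (I₀ : Matrix (Fin p) (Fin p) ℝ) : Prop where
  measurable : Measurable l
  memLp : MemLp l 2 (P h₀)
  mem_closure : ∀ j, ∀ ε > 0, ∃ f ∈ Submodule.span ℝ (tangentSet P T h₀),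
    eLpNorm (fun x => l x j - f x) 2 (P h₀) ≤ ENNReal.ofReal ε
  information : ∀ i j, I₀ i j = ∫ x, l x i * l x j ∂(P h₀)
  posDef : I₀.PosDef
  derivative : ∀ γ ∈ T, γ 0 = h₀ → ∀ g, IsScore P γ g →
    Tendsto (fun t : ℝ => t⁻¹ • (phi (γ t) - phi h₀)) (𝓝[>] 0)
      (𝓝 (WithLp.toLp 2 (I₀⁻¹.mulVec fun j => ∫ x, l x j * g x ∂(P h₀))))

/-- `Δ_n = n^{-1/2} ∑_{i ≤ n} I₀⁻¹ l(X_i)`. -/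
def centering {p n : ℕ} (l : 𝒳 → Euc p) (I₀ : Matrix (Fin p) (Fin p) ℝ) (D : Fin n → 𝒳) :
    Euc p :=
  (√n)⁻¹ • ∑ i, WithLp.toLp 2 (I₀⁻¹.mulVec (l (D i)))

end Bayes

/-- The row vector `λᵀ ∇_φ Ψ`. -/
def sensitivity {k p : ℕ} (l : Euc k) (J : Matrix (Fin k) (Fin p) ℝ) : Euc p :=
  WithLp.toLp 2 (Matrix.vecMul l J)

/-- The quadratic form `vᵀ I₀⁻¹ v`. -/
def invQuadForm {p : ℕ} (I₀ : Matrix (Fin p) (Fin p) ℝ) (v : Euc p) : ℝ :=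
  dotProduct v (I₀⁻¹.mulVec v)

end

/-! ### Total variation distance: contraction and coupling bounds. -/

section TotalVariation

variable {α β : Type*} [MeasurableSpace α] [MeasurableSpace β]

/-! The support function is strictly differentiable in `φ` at `φ₀` with gradient `-v`, `v = λᵀ∇_φΨ`:
on a small fixed ball it equals `-⟨v, φ⟩ + R(φ)` with `R` Lipschitz of arbitrarily small constant
`ε`. Strictness matters, since smallness of the values of a remainder would not control total
variation, while smallness of its Lipschitz constant does.

Strict differentiability (`exists_lipschitzOnWith_supportFun_add`) is an envelope argument. Testing
the multiplier of `φ₁` at a maximizer of `φ₂` bounds `S(φ₂) - S(φ₁)` by an increment of `-λ(φ₁)ᵀΨ(θ,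
·)`. By compactness its gradient is close to `-v`, because all maximizers at `φ₀` yield the same
`v`.

With `z = √n(φ - φ₀)`, the rescaled support function is `-⟨v, z⟩` plus a rescaling of `R` that is
still `ε`-Lipschitz, whatever `n` is. The posterior leaves the ball with vanishing probability, and
total variation contracts under maps, so the law of `z` may be replaced by its Gaussian limit. A
linear functional of a Gaussian perturbed by an `ε`-Lipschitz function is close to the unperturbed
one (`exists_tvDist_map_multivariateGaussian_le`): the perturbation is absorbed into a near-identity
change of variables of the standard Gaussian. This is uniform over bounded means, and the means
`Δ_n` are bounded in probability because the efficient score is centered and square integrable. -/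

lemma tvDist_le {P Q : Measure α} {c : ℝ}
    (h : ∀ B, MeasurableSet B → |P.real B - Q.real B| ≤ c) : tvDist P Q ≤ c :=
  haveI : Nonempty {B : Set α // MeasurableSet B} := ⟨⟨∅, .empty⟩⟩
  ciSup_le fun B => h B.1 B.2

lemma tvDist_nonneg (P Q : Measure α) : 0 ≤ tvDist P Q :=
  Real.iSup_nonneg fun _ => abs_nonneg _

lemma abs_measureReal_sub_le_tvDist (P Q : Measure α) [IsFiniteMeasure P] [IsFiniteMeasure Q]
    {B : Set α} (hB : MeasurableSet B) : |P.real B - Q.real B| ≤ tvDist P Q := by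
  refine le_ciSup (f := fun B : {B : Set α // MeasurableSet B} => |P.real B - Q.real B|)
    ⟨P.real Set.univ + Q.real Set.univ, ?_⟩ ⟨B, hB⟩
  rintro _ ⟨B, rfl⟩
  have h1 : P.real B ≤ P.real Set.univ := measureReal_mono (Set.subset_univ _)
  have h2 : Q.real B ≤ Q.real Set.univ := measureReal_mono (Set.subset_univ _)
  have h3 : 0 ≤ P.real (B : Set α) := measureReal_nonneg
  have h4 : 0 ≤ Q.real (B : Set α) := measureReal_nonneg
  exact abs_sub_le_iff.2 ⟨by linarith, by linarith⟩

lemma tvDist_triangle (P Q R : Measure α) [IsFiniteMeasure P] [IsFiniteMeasure Q]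
    [IsFiniteMeasure R] : tvDist P R ≤ tvDist P Q + tvDist Q R :=
  tvDist_le fun _ hB => (abs_sub_le _ _ _).trans
    (add_le_add (abs_measureReal_sub_le_tvDist P Q hB) (abs_measureReal_sub_le_tvDist Q R hB))

lemma tvDist_map_le (P Q : Measure α) [IsFiniteMeasure P] [IsFiniteMeasure Q] {f : α → β}
    (hf : Measurable f) : tvDist (P.map f) (Q.map f) ≤ tvDist P Q :=
  tvDist_le fun B hB => by
    rw [map_measureReal_apply hf hB, map_measureReal_apply hf hB]
    exact abs_measureReal_sub_le_tvDist P Q (hf hB)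

/-- Applying the one-sided bound to complements gives the reverse one, so only upper estimates are
needed below. -/
lemma tvDist_le_of_forall_le (P Q : Measure α) [IsProbabilityMeasure P] [IsProbabilityMeasure Q]
    {c : ℝ} (h : ∀ B, MeasurableSet B → P.real B ≤ Q.real B + c) : tvDist P Q ≤ c :=
  tvDist_le fun B hB => by
    have h1 := h B hB
    have h2 := h Bᶜ hB.compl
    rw [probReal_compl_eq_one_sub hB, probReal_compl_eq_one_sub hB] at h2
    exact abs_sub_le_iff.2 ⟨by linarith, by linarith⟩

/-- Coupling inequality: the two images can differ only on the event `Aᶜ`. -/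
lemma tvDist_map_map_le_of_eqOn (P : Measure α) [IsProbabilityMeasure P] {f g : α → β}
    (hf : Measurable f) (hg : Measurable g) {A : Set α} (hA : MeasurableSet A)
    (h : Set.EqOn f g A) : tvDist (P.map f) (P.map g) ≤ 1 - P.real A := by
  have : IsProbabilityMeasure (P.map f) := Measure.isProbabilityMeasure_map hf.aemeasurable
  have : IsProbabilityMeasure (P.map g) := Measure.isProbabilityMeasure_map hg.aemeasurable
  refine tvDist_le_of_forall_le _ _ fun B hB => ?_
  rw [map_measureReal_apply hf hB, map_measureReal_apply hg hB, ← probReal_compl_eq_one_sub hA]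
  refine (measureReal_mono (s₂ := g ⁻¹' B ∪ Aᶜ) fun x hx => ?_).trans (measureReal_union_le _ _)
  by_cases hxA : x ∈ A
  · exact Or.inl (by simpa [← h hxA] using hx)
  · exact Or.inr hxA

end TotalVariation

/-! ### Gaussian laws under small Lipschitz perturbations. -/

section Gaussian

variable {p : ℕ}

open scoped ENNReal NNReal MatrixOrder

/-- The density of the standard Gaussian distribution on `ℝᵖ`. -/
noncomputable def stdGaussianPDF (p : ℕ) (x : Euc p) : ℝ :=
  ((2 * Real.pi) ^ ((p : ℝ) / 2))⁻¹ * Real.exp (-‖x‖ ^ 2 / 2)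

lemma continuous_stdGaussianPDF : Continuous (stdGaussianPDF p) := by
  unfold stdGaussianPDF; fun_prop

lemma stdGaussianPDF_nonneg (x : Euc p) : 0 ≤ stdGaussianPDF p x := by
  unfold stdGaussianPDF; positivity

lemma integrable_exp_neg_norm_sq_div_two :
    Integrable (fun x : Euc p => Real.exp (-‖x‖ ^ 2 / 2)) := by
  have h := GaussianFourier.integrable_cexp_neg_mul_sq_norm_add (V := Euc p)
    (b := 1 / 2) (by norm_num) 0 0
  refine (h.norm).congr (ae_of_all _ fun x => ?_)
  simp only [Complex.norm_exp]
  congr 1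
  simp [← Complex.ofReal_pow]
  norm_cast
  ring

/-- Both measures have characteristic function `exp(-‖t‖²/2)`. -/
lemma stdGaussian_eq_withDensity : stdGaussian (Euc p) =
    volume.withDensity fun x => ENNReal.ofReal (stdGaussianPDF p x) := by
  have hint : Integrable (stdGaussianPDF p) := integrable_exp_neg_norm_sq_div_two.const_mul _
  have : IsFiniteMeasure
      ((volume : Measure (Euc p)).withDensity fun x => ENNReal.ofReal (stdGaussianPDF p x)) :=
    isFiniteMeasure_withDensity_ofReal hint.2
  refine Measure.ext_of_charFun ?_
  ext t
  rw [charFun_stdGaussian, charFun_apply, integral_withDensity_eq_integral_toReal_smul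
    continuous_stdGaussianPDF.measurable.ennreal_ofReal (by simp)]
  have key := GaussianFourier.integral_cexp_neg_mul_sq_norm_add (V := Euc p)
    (b := 1 / 2) (by norm_num) Complex.I t
  have e : ∀ v : Euc p, (ENNReal.ofReal (stdGaussianPDF p v)).toReal •
      Complex.exp ((inner ℝ v t : ℝ) * Complex.I) =
      (((2 * Real.pi) ^ ((p : ℝ) / 2))⁻¹ : ℝ) *
        Complex.exp (-(1 / 2) * (‖v‖ : ℂ) ^ 2 + Complex.I * (inner ℝ t v : ℝ)) := by
    intro v
    rw [ENNReal.toReal_ofReal (stdGaussianPDF_nonneg v), stdGaussianPDF, Complex.real_smul,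
      Complex.exp_add, real_inner_comm]
    push_cast
    rw [mul_assoc, mul_comm Complex.I]
    congr 3
    ring
  simp_rw [e]
  rw [integral_const_mul, key, finrank_euclideanSpace_fin, ← mul_assoc]
  have h2 : ((Real.pi : ℂ) / (1 / 2)) ^ ((p : ℂ) / 2) =
      (((2 * Real.pi) ^ ((p : ℝ) / 2) : ℝ) : ℂ) := by
    rw [Complex.ofReal_cpow (by positivity)]
    push_cast
    congr 1
    ring
  rw [h2, ← Complex.ofReal_mul, inv_mul_cancel₀ (by positivity), Complex.I_sq]
  push_cast
  rw [one_mul]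
  congr 1
  ring

/-- Hausdorff measure of dimension `p` has this scaling, and Lebesgue measure is a multiple of it.
It serves as a change of variables without a Jacobian. -/
lemma AntilipschitzWith.volume_preimage_le {T : Euc p → Euc p} {K : ℝ≥0}
    (hT : AntilipschitzWith K T) (B : Set (Euc p)) :
    volume (T ⁻¹' B) ≤ (K : ℝ≥0∞) ^ p * volume B := by
  have h := hT.hausdorffMeasure_preimage_le (d := Module.finrank ℝ (Euc p)) (by positivity) B
  rw [Measure.isAddLeftInvariant_eq_smul (volume : Measure (Euc p))
    (μH[Module.finrank ℝ (Euc p)])]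
  simp only [Measure.smul_apply, finrank_euclideanSpace_fin, ENNReal.rpow_natCast] at h ⊢
  rw [ENNReal.smul_def, ENNReal.smul_def, smul_eq_mul, smul_eq_mul, mul_left_comm]
  gcongr

/-- A Lipschitz perturbation of the identity is antilipschitz. -/
lemma antilipschitzWith_of_norm_sub_sub_le {E : Type*} [NormedAddCommGroup E] {T : E → E} {ε : ℝ}
    (hε : ε < 1) (h : ∀ x y, ‖(T x - x) - (T y - y)‖ ≤ ε * ‖x - y‖) :
    AntilipschitzWith (Real.toNNReal (1 - ε)⁻¹) T := by
  refine AntilipschitzWith.of_le_mul_dist fun x y => ?_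
  rw [Real.coe_toNNReal _ (by simp; linarith), dist_eq_norm, dist_eq_norm, inv_mul_eq_div,
    le_div_iff₀ (by linarith)]
  have h1 := h x y
  have h2 : ‖x - y‖ ≤ ‖T x - T y‖ + ‖(T x - x) - (T y - y)‖ := by
    have := norm_sub_le (T x - T y) ((T x - x) - (T y - y))
    rwa [show T x - T y - (T x - x - (T y - y)) = x - y by abel] at this
  linarith

/-- The ratio of the densities is `exp(-(‖y‖² - ‖x‖²)/2)`, bounded below by `1 + t ≤ exp t`. The
relative error is a multiple of `ε` with a Gaussian-integrable quadratic factor. -/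
lemma stdGaussianPDF_le {x y : Euc p} {M ε : ℝ} (hM : 0 ≤ M) (hε : 0 ≤ ε) (hε1 : ε ≤ 1)
    (h : ‖y - x‖ ≤ ε * (M + ‖x‖)) :
    stdGaussianPDF p x ≤
      stdGaussianPDF p y + stdGaussianPDF p x * (ε * (M + 3 * ‖x‖) ^ 2) := by
  have hx := norm_nonneg x
  have hy : ‖y‖ ≤ ‖x‖ + ε * (M + ‖x‖) := by
    have := norm_add_le x (y - x)
    rw [add_sub_cancel] at this
    linarith
  have h0 : 0 ≤ ε * (M + ‖x‖) := by positivity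
  have h1 : ε * (M + ‖x‖) ≤ M + ‖x‖ := mul_le_of_le_one_left (by positivity) hε1
  have hsq : (‖y‖ ^ 2 - ‖x‖ ^ 2) / 2 ≤ ε * (M + 3 * ‖x‖) ^ 2 := by
    have h2 : ‖y‖ ^ 2 ≤ (‖x‖ + ε * (M + ‖x‖)) ^ 2 := by gcongr
    have h3 : ε * (M + ‖x‖) * (2 * ‖x‖ + ε * (M + ‖x‖)) ≤
        ε * (M + 3 * ‖x‖) * (M + 3 * ‖x‖) :=
      mul_le_mul (mul_le_mul_of_nonneg_left (by linarith) hε) (by linarith) (by positivity)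
        (by positivity)
    have h4 : 0 ≤ ε * (M + 3 * ‖x‖) ^ 2 := by positivity
    nlinarith
  have hexp : Real.exp (-‖y‖ ^ 2 / 2) =
      Real.exp (-‖x‖ ^ 2 / 2) * Real.exp (-((‖y‖ ^ 2 - ‖x‖ ^ 2) / 2)) := by
    rw [← Real.exp_add]; ring_nf
  have h5 := Real.add_one_le_exp (-((‖y‖ ^ 2 - ‖x‖ ^ 2) / 2))
  have h6 : stdGaussianPDF p y =
      stdGaussianPDF p x * Real.exp (-((‖y‖ ^ 2 - ‖x‖ ^ 2) / 2)) := by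
    simp only [stdGaussianPDF]
    rw [hexp, mul_assoc]
  rw [h6, ← mul_add]
  exact le_mul_of_one_le_right (stdGaussianPDF_nonneg x) (by linarith)

/-- Replace the density at `x` by the density at `T x`, at a cost of order `ε`, then push Lebesgue
measure forward along `T`, which inflates it by at most `(1 - ε)⁻¹ ^ p`. -/
lemma stdGaussian_preimage_le {T : Euc p → Euc p} (hT : Measurable T) {M ε : ℝ}
    (hM : 0 ≤ M) (hε : 0 ≤ ε) (hε1 : ε < 1)
    (hlip : ∀ x y, ‖(T x - x) - (T y - y)‖ ≤ ε * ‖x - y‖)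
    (hbd : ∀ x, ‖T x - x‖ ≤ ε * (M + ‖x‖)) {B : Set (Euc p)} (hB : MeasurableSet B) :
    stdGaussian (Euc p) (T ⁻¹' B) ≤
      ENNReal.ofReal ((1 - ε)⁻¹ ^ p) * stdGaussian (Euc p) B +
        ENNReal.ofReal ε * ∫⁻ x, ENNReal.ofReal ((M + 3 * ‖x‖) ^ 2) ∂stdGaussian (Euc p) := by
  have hd : Measurable fun x => ENNReal.ofReal (stdGaussianPDF p x) :=
    continuous_stdGaussianPDF.measurable.ennreal_ofReal
  have hmap : (volume : Measure (Euc p)).map T ≤ ENNReal.ofReal ((1 - ε)⁻¹ ^ p) • volume := by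
    refine Measure.le_iff.2 fun s hs => ?_
    rw [Measure.map_apply hT hs, Measure.smul_apply, smul_eq_mul,
      ENNReal.ofReal_pow (by simp; linarith)]
    exact (antilipschitzWith_of_norm_sub_sub_le hε1 hlip).volume_preimage_le s
  have hq : Measurable fun x : Euc p => ENNReal.ofReal ((M + 3 * ‖x‖) ^ 2) := by fun_prop
  calc stdGaussian (Euc p) (T ⁻¹' B)
      = ∫⁻ x in T ⁻¹' B, ENNReal.ofReal (stdGaussianPDF p x) := by
        rw [stdGaussian_eq_withDensity, withDensity_apply _ (hT hB)]
    _ ≤ ∫⁻ x in T ⁻¹' B, (ENNReal.ofReal (stdGaussianPDF p (T x)) +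
          ENNReal.ofReal ε *
            (ENNReal.ofReal (stdGaussianPDF p x) * ENNReal.ofReal ((M + 3 * ‖x‖) ^ 2))) := by
        refine lintegral_mono fun x => ?_
        rw [← ENNReal.ofReal_mul (stdGaussianPDF_nonneg x), ← ENNReal.ofReal_mul hε,
          ← ENNReal.ofReal_add (stdGaussianPDF_nonneg _)
            (mul_nonneg hε (mul_nonneg (stdGaussianPDF_nonneg x) (sq_nonneg _)))]
        refine ENNReal.ofReal_le_ofReal ((stdGaussianPDF_le hM hε hε1.le (hbd x)).trans_eq ?_)
        ring
    _ = ∫⁻ x in B, ENNReal.ofReal (stdGaussianPDF p x) ∂(volume.map T) +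
          ENNReal.ofReal ε * ∫⁻ x in T ⁻¹' B,
            ENNReal.ofReal (stdGaussianPDF p x) * ENNReal.ofReal ((M + 3 * ‖x‖) ^ 2) := by
        rw [lintegral_add_left (f := fun x => ENNReal.ofReal (stdGaussianPDF p (T x))) (hd.comp hT),
          lintegral_const_mul' _ _ ENNReal.ofReal_ne_top,
          setLIntegral_map hB hd hT]
    _ ≤ ∫⁻ x in B, ENNReal.ofReal (stdGaussianPDF p x) ∂(ENNReal.ofReal ((1 - ε)⁻¹ ^ p) • volume) +
          ENNReal.ofReal ε * ∫⁻ x,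
            ENNReal.ofReal (stdGaussianPDF p x) * ENNReal.ofReal ((M + 3 * ‖x‖) ^ 2) := by
        gcongr
        exact Measure.restrict_le_self
    _ = _ := by
        rw [Measure.restrict_smul, lintegral_smul_measure, smul_eq_mul, stdGaussian_eq_withDensity,
          withDensity_apply _ hB, lintegral_withDensity_eq_lintegral_mul _ hd hq]
        rfl

lemma integrable_add_mul_norm_sq_stdGaussian (M : ℝ) :
    Integrable (fun x => (M + 3 * ‖x‖) ^ 2) (stdGaussian (Euc p)) := by
  have h : MemLp (fun x : Euc p => x) 2 (stdGaussian (Euc p)) := IsGaussian.memLp_two_id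
  exact (((memLp_const M).add (h.norm.const_mul 3))).integrable_sq

/-- Small Lipschitz perturbations of the identity move the standard Gaussian distribution little
in total variation. -/
lemma exists_tvDist_map_stdGaussian_le (p : ℕ) {M η : ℝ} (hM : 0 ≤ M) (hη : 0 < η) :
    ∃ ε > 0, ∀ T : Euc p → Euc p, Measurable T →
      (∀ x y, ‖(T x - x) - (T y - y)‖ ≤ ε * ‖x - y‖) → (∀ x, ‖T x - x‖ ≤ ε * (M + ‖x‖)) →
      tvDist ((stdGaussian (Euc p)).map T) (stdGaussian (Euc p)) ≤ η := by
  set I : ℝ := ∫ x, (M + 3 * ‖x‖) ^ 2 ∂stdGaussian (Euc p) with hI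
  have hI0 : 0 ≤ I := integral_nonneg fun x => sq_nonneg _
  have hIl : ∫⁻ x, ENNReal.ofReal ((M + 3 * ‖x‖) ^ 2) ∂stdGaussian (Euc p) = ENNReal.ofReal I :=
    (ofReal_integral_eq_lintegral_ofReal (integrable_add_mul_norm_sq_stdGaussian M)
      (ae_of_all _ fun x => sq_nonneg _)).symm
  -- The total error for a perturbation of size `ε`.
  have hlim : Tendsto (fun ε : ℝ => ((1 - ε)⁻¹ ^ p - 1) + ε * I) (𝓝[>] 0) (𝓝 0) := by
    have : ContinuousAt (fun ε : ℝ => ((1 - ε)⁻¹ ^ p - 1) + ε * I) 0 := by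
      have : (1 : ℝ) - 0 ≠ 0 := by norm_num
      fun_prop (disch := assumption)
    have h := this.tendsto
    simp only [sub_zero, inv_one, one_pow, sub_self, zero_mul, add_zero] at h
    exact h.mono_left nhdsWithin_le_nhds
  obtain ⟨ε, ⟨hε, hε1⟩, hε0⟩ := ((hlim.eventually_le_const hη).and
    (mem_of_superset (Ioo_mem_nhdsGT (zero_lt_one' ℝ)) fun x hx => hx.2) |>.and
      self_mem_nhdsWithin).exists
  have hε0 : 0 < ε := hε0
  have hε1 : ε < 1 := hε1
  refine ⟨ε, hε0, fun T hT hlip hbd => ?_⟩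
  have : IsProbabilityMeasure ((stdGaussian (Euc p)).map T) :=
    Measure.isProbabilityMeasure_map hT.aemeasurable
  refine tvDist_le_of_forall_le _ _ fun B hB => ?_
  have h := stdGaussian_preimage_le hT hM hε0.le hε1 hlip hbd hB
  have hpow : 1 ≤ (1 - ε)⁻¹ ^ p := one_le_pow₀ ((one_le_inv₀ (by linarith)).2 (by linarith))
  rw [hIl, ← ofReal_measureReal, ← ofReal_measureReal, ← ENNReal.ofReal_mul (by positivity),
    ← ENNReal.ofReal_mul hε0.le, ← ENNReal.ofReal_add (by positivity) (by positivity),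
    ENNReal.ofReal_le_ofReal_iff (by positivity)] at h
  rw [map_measureReal_apply hT hB]
  have h1 : (stdGaussian (Euc p)).real B ≤ 1 := measureReal_le_one
  nlinarith

lemma map_inner_multivariateGaussian {S : Matrix (Fin p) (Fin p) ℝ} (hS : S.PosSemidef)
    (m g : Euc p) : (multivariateGaussian m S).map (fun z => inner ℝ g z) =
      gaussianReal (inner ℝ g m) (g ⬝ᵥ S.mulVec g).toNNReal := by
  have h := IsGaussian.map_eq_gaussianReal (μ := multivariateGaussian m S) (innerSL ℝ g)
  have h1 : (multivariateGaussian m S)[innerSL ℝ g] = inner ℝ g m := by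
    rw [(innerSL ℝ g).integral_comp_id_comm IsGaussian.integrable_id]
    simp
  have h2 : Var[innerSL ℝ g; multivariateGaussian m S] = g ⬝ᵥ S.mulVec g := by
    rw [← covarianceBilin_multivariateGaussian (μ := m) hS,
      covarianceBilin_self IsGaussian.memLp_two_id]
    rfl
  rw [h1, h2] at h
  exact h

/-- The total variation version of the delta method for a Gaussian distribution. -/
lemma exists_tvDist_map_multivariateGaussian_le {S : Matrix (Fin p) (Fin p) ℝ}
    (hS : S.PosSemidef) {g : Euc p} (hg : 0 < g ⬝ᵥ S.mulVec g) {M η : ℝ} (hM : 0 ≤ M)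
    (hη : 0 < η) :
    ∃ ε : ℝ≥0, 0 < ε ∧ ∀ m : Euc p, ‖m‖ ≤ M → ∀ R : Euc p → ℝ, LipschitzWith ε R → R 0 = 0 →
      tvDist ((multivariateGaussian m S).map fun z => inner ℝ g z + R z)
        (gaussianReal (inner ℝ g m) (g ⬝ᵥ S.mulVec g).toNNReal) ≤ η := by
  set A := Matrix.toEuclideanCLM (𝕜 := ℝ) (n := Fin p) (CFC.sqrt S) with hA
  -- With `z = m + A x` and `x` standard Gaussian, `⟨g, z⟩ = ⟨g, m⟩ + ⟨b, x⟩`. If `b` vanished this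
  -- would have zero variance.
  set b : Euc p := ContinuousLinearMap.adjoint A g with hb
  have hb0 : b ≠ 0 := by
    intro h0
    have h1 := map_inner_multivariateGaussian hS 0 g
    have h2 : (multivariateGaussian 0 S).map (fun z => inner ℝ g z) = Measure.dirac 0 := by
      rw [multivariateGaussian, Measure.map_map (by fun_prop) (by fun_prop)]
      have : (fun z => inner ℝ g z) ∘ (fun x : Euc p => (0 : Euc p) + A x) = fun _ => (0 : ℝ) := by
        ext x
        simp only [Function.comp, zero_add]
        rw [← ContinuousLinearMap.adjoint_inner_left, ← hb, h0, inner_zero_left]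
      rw [← hA, this, Measure.map_const]
      simp
    rw [h2] at h1
    have h3 := congrArg (fun μ => Var[id; μ]) h1
    simp only [variance_id_gaussianReal, variance_dirac] at h3
    rw [Real.coe_toNNReal _ hg.le] at h3
    exact hg.ne h3
  set c : ℝ := ‖b‖⁻¹ * (1 + ‖A‖) with hc
  have hbn : 0 < ‖b‖ := norm_pos_iff.2 hb0
  have hc0 : 0 < c := by positivity
  obtain ⟨ε, hε, H⟩ := exists_tvDist_map_stdGaussian_le p hM hη
  refine ⟨(ε / c).toNNReal, by simpa using div_pos hε hc0, fun m hm R hR hR0 => ?_⟩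
  have hεc : ((ε / c).toNNReal : ℝ) = ε / c := Real.coe_toNNReal _ (by positivity)
  have hRc : Continuous R := hR.continuous
  set r : Euc p → ℝ := fun x => R (m + A x) with hr
  -- The displacement along `b` is chosen so that `⟨b, T x⟩ = ⟨b, x⟩ + r x`: the affine map `G`
  -- after `T` reproduces the perturbed functional.
  set T : Euc p → Euc p := fun x => x + (r x / ‖b‖ ^ 2) • b with hT
  have hTc : Continuous T := by fun_prop
  have hnorm : ∀ t : ℝ, ‖(t / ‖b‖ ^ 2) • b‖ = ‖b‖⁻¹ * |t| := by
    intro t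
    rw [norm_smul, Real.norm_eq_abs, abs_div, abs_of_pos (by positivity : (0 : ℝ) < ‖b‖ ^ 2)]
    field_simp
  have hmul : ∀ u v : ℝ, |u| ≤ ε / c * ((1 + ‖A‖) * v) → ‖b‖⁻¹ * |u| ≤ ε * v := by
    intro u v huv
    calc ‖b‖⁻¹ * |u| ≤ ‖b‖⁻¹ * (ε / c * ((1 + ‖A‖) * v)) := by gcongr
      _ = ε * v := by rw [hc]; field_simp
  have key := H T hTc.measurable (fun x y => by
      have e : (T x - x) - (T y - y) = ((r x - r y) / ‖b‖ ^ 2) • b := by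
        simp only [hT]; rw [sub_div, sub_smul]; abel
      rw [e, hnorm]
      refine hmul _ _ ?_
      have h1 := hR.dist_le_mul (m + A x) (m + A y)
      rw [Real.dist_eq, dist_eq_norm, add_sub_add_left_eq_sub, ← map_sub, hεc] at h1
      refine h1.trans ?_
      gcongr
      exact (A.le_opNorm _).trans (by nlinarith [norm_nonneg (x - y)])) (fun x => by
      have e : T x - x = (r x / ‖b‖ ^ 2) • b := by simp [hT]
      rw [e, hnorm]
      refine hmul _ _ ?_
      have h1 := hR.dist_le_mul (m + A x) 0
      rw [Real.dist_eq, dist_eq_norm, hR0, sub_zero, sub_zero, hεc] at h1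
      refine h1.trans ?_
      gcongr
      have h2 := norm_add_le m (A x)
      have h3 := A.le_opNorm x
      have h4 := norm_nonneg A
      have h5 := norm_nonneg x
      nlinarith)
  set G : Euc p → ℝ := fun x => inner ℝ g m + inner ℝ b x with hG
  have hGm : Measurable G := by fun_prop
  have hAadj : ∀ x, inner ℝ g (A x) = inner ℝ b x := fun x => by
    rw [hb, ContinuousLinearMap.adjoint_inner_left]
  have e1 : (multivariateGaussian m S).map (fun z => inner ℝ g z + R z) =
      ((stdGaussian (Euc p)).map T).map G := by
    rw [multivariateGaussian, Measure.map_map (by fun_prop) (by fun_prop),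
      Measure.map_map hGm hTc.measurable]
    congr 1
    ext x
    simp only [Function.comp, hG, hT, hr, ← hA, inner_add_right, hAadj, inner_smul_right,
      real_inner_self_eq_norm_sq]
    field_simp
    ring
  have e2 : gaussianReal (inner ℝ g m) (g ⬝ᵥ S.mulVec g).toNNReal =
      (stdGaussian (Euc p)).map G := by
    rw [← map_inner_multivariateGaussian hS, multivariateGaussian,
      Measure.map_map (by fun_prop) (by fun_prop)]
    congr 1
    ext x
    simp only [Function.comp, hG, ← hA, inner_add_right, hAadj]
  rw [e1, e2]
  have : IsProbabilityMeasure ((stdGaussian (Euc p)).map T) :=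
    Measure.isProbabilityMeasure_map hTc.measurable.aemeasurable
  exact (tvDist_map_le _ _ hGm).trans key

end Gaussian

/-! ### Measurability and strict differentiability of the support function. -/

section SupportFunction

open scoped NNReal

variable {d p k : ℕ} {Θ : Set (Euc d)} {Φ : Set (Euc p)} {Ψ : Euc d → Euc p → Euc k}
  {φ φ₀ φ₁ φ₂ : Euc p} {ν θ : Euc d}

lemma isClosed_setOf_nonpos (k : ℕ) : IsClosed {y : Euc k | ∀ i, y i ≤ 0} := by
  simp only [Set.ofPred_forall]
  exact isClosed_iInter fun i => isClosed_le (by fun_prop) continuous_const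

lemma isCompact_identifiedSet (hΘ : IsCompact Θ)
    (hΨ : ContinuousOn (fun q : Euc d × Euc p => Ψ q.1 q.2) (Θ ×ˢ Φ)) (hφ : φ ∈ Φ) :
    IsCompact (identifiedSet Θ Ψ φ) := by
  have hc : ContinuousOn (fun θ => Ψ θ φ) Θ :=
    hΨ.comp (f := fun θ => (θ, φ)) (by fun_prop) fun θ hθ => ⟨hθ, hφ⟩
  exact hΘ.of_isClosed_subset (hc.preimage_isClosed_of_isClosed hΘ.isClosed
    (isClosed_setOf_nonpos k)) fun θ hθ => hθ.1

lemma supportSet_nonempty (h : IsCompact (identifiedSet Θ Ψ φ))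
    (hne : (identifiedSet Θ Ψ φ).Nonempty) (ν : Euc d) : (supportSet Θ Ψ ν φ).Nonempty := by
  obtain ⟨θ, hθ, hmax⟩ := h.exists_isMaxOn hne (f := fun θ => inner ℝ ν θ) (by fun_prop)
  exact ⟨θ, hθ, fun θ' hθ' => hmax hθ'⟩

lemma supportFun_eq_inner (h : θ ∈ supportSet Θ Ψ ν φ) : supportFun Θ Ψ φ ν = inner ℝ ν θ :=
  IsGreatest.csSup_eq ⟨⟨θ, h.1, rfl⟩, by rintro _ ⟨θ', h', rfl⟩; exact h.2 θ' h'⟩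

lemma inner_nonpos_of_nonneg_of_nonpos {l y : Euc k} (hl : ∀ i, 0 ≤ l i) (hy : ∀ i, y i ≤ 0) :
    inner ℝ l y ≤ 0 := by
  rw [PiLp.inner_apply]
  exact Finset.sum_nonpos fun i _ => by
    simpa using mul_nonpos_of_nonpos_of_nonneg (hy i) (hl i)

/-- Since `θ` is optimal at `φ₂` and admissible in the Lagrangian supremum at `φ₁`, weak duality
gives the bound after dropping `λᵀΨ(θ, φ₂) ≤ 0`. -/
lemma supportFun_sub_le {l : Euc k} (hl : IsLagrangeMultiplier Θ Ψ ν φ₁ l)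
    (hθ : θ ∈ supportSet Θ Ψ ν φ₂) :
    supportFun Θ Ψ φ₂ ν - supportFun Θ Ψ φ₁ ν ≤ -(inner ℝ l (Ψ θ φ₂) - inner ℝ l (Ψ θ φ₁)) := by
  have h1 := hl.2.1 ⟨θ, hθ.1.1, rfl⟩
  have h2 := inner_nonpos_of_nonneg_of_nonpos hl.1 hθ.1.2
  rw [supportFun_eq_inner hθ]
  simp only at h1
  linarith

/-- Suprema are attained, so superlevel sets are projections along the compact `Θ` of closed sets,
hence closed, apart from the parameters with empty identified set. -/
lemma measurable_supportFun (hΘ : IsCompact Θ)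
    (hΨ : ContinuousOn (fun q : Euc d × Euc p => Ψ q.1 q.2) (Θ ×ˢ Φ)) (ν : Euc d) :
    Measurable fun φ : Φ => supportFun Θ Ψ φ ν := by
  have : CompactSpace Θ := isCompact_iff_compactSpace.1 hΘ
  have hc : Continuous fun q : Θ × Φ => Ψ q.1 q.2 :=
    hΨ.comp_continuous (f := fun q : Θ × Φ => ((q.1 : Euc d), (q.2 : Euc p))) (by fun_prop)
      fun q => ⟨q.1.2, q.2.2⟩
  have hcl : ∀ F : Set (Euc d), IsClosed F →
      IsClosed {φ : Φ | ∃ θ ∈ identifiedSet Θ Ψ φ, θ ∈ F} := by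
    intro F hF
    have h1 : IsClosed {q : Θ × Φ | (∀ i, Ψ q.1 q.2 i ≤ 0) ∧ (q.1 : Euc d) ∈ F} :=
      ((isClosed_setOf_nonpos k).preimage hc).inter (hF.preimage (by fun_prop))
    convert isClosedMap_snd_of_compactSpace _ h1 using 1
    ext φ
    constructor
    · rintro ⟨θ, hθ, hF⟩
      exact ⟨(⟨θ, hθ.1⟩, φ), ⟨hθ.2, hF⟩, rfl⟩
    · rintro ⟨⟨θ, φ⟩, ⟨h, hF⟩, rfl⟩
      exact ⟨θ, ⟨θ.2, h⟩, hF⟩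
  refine measurable_of_Ici fun c => ?_
  -- On an empty identified set `sSup` takes the default value `0`, which lies in `Ici c` exactly
  -- when `c ≤ 0`.
  have e : (fun φ : Φ => supportFun Θ Ψ φ ν) ⁻¹' Set.Ici c =
      {φ : Φ | ∃ θ ∈ identifiedSet Θ Ψ φ, θ ∈ {θ | c ≤ inner ℝ ν θ}} ∪
        ({φ : Φ | ∃ θ ∈ identifiedSet Θ Ψ φ, θ ∈ Set.univ}ᶜ ∩ {_φ : Φ | c ≤ 0}) := by
    ext φ
    rcases (identifiedSet Θ Ψ φ).eq_empty_or_nonempty with h | h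
    · simp [h, supportFun]
    · obtain ⟨θ, hθ⟩ := supportSet_nonempty (isCompact_identifiedSet hΘ hΨ φ.2) h ν
      have h' : ∃ θ, θ ∈ identifiedSet Θ Ψ φ := h
      simp only [Set.mem_preimage, Set.mem_Ici, supportFun_eq_inner hθ, Set.mem_union,
        Set.mem_ofPred_eq, Set.mem_inter_iff, Set.mem_compl_iff, Set.mem_univ, and_true, h',
        not_true, false_and, or_false]
      exact ⟨fun hc => ⟨θ, hθ.1, hc⟩, fun ⟨θ', hθ', hc⟩ => hc.trans (hθ.2 θ' hθ')⟩
  rw [e]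
  exact (hcl _ (isClosed_le continuous_const (by fun_prop))).measurableSet.union
    ((hcl _ isClosed_univ).measurableSet.compl.inter (MeasurableSet.const _))

lemma hasFDerivAt_inner_multiplier (h : DifferentiableAt ℝ (fun φ' => Ψ θ φ') φ) (l : Euc k) :
    HasFDerivAt (fun φ' => inner ℝ l (Ψ θ φ'))
      (innerSL ℝ (sensitivity l (jacParam Ψ θ φ))) φ := by
  have e : innerSL ℝ (sensitivity l (jacParam Ψ θ φ)) =
      (innerSL ℝ l).comp (fderiv ℝ (fun φ' => Ψ θ φ') φ) := by
    apply ContinuousLinearMap.coe_injective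
    refine (EuclideanSpace.basisFun (Fin p) ℝ).toBasis.ext fun j => ?_
    simp [sensitivity, jacParam, Matrix.vecMul, dotProduct, PiLp.inner_apply, mul_comm]
  rw [e]
  exact (innerSL ℝ l : Euc k →L[ℝ] ℝ).hasFDerivAt.comp φ h.hasFDerivAt

lemma continuous_sensitivity :
    Continuous fun q : Euc k × Matrix (Fin k) (Fin p) ℝ => sensitivity q.1 q.2 := by
  unfold sensitivity
  refine (PiLp.continuous_toLp 2 _).comp ?_
  exact Continuous.matrix_vecMul (by fun_prop) continuous_snd

variable {lam : Euc d → Euc p → Euc k} {K δ : ℝ}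

/-- A competitor `θ'` feasible at `φ₀` may be infeasible at `φs n`, but the Lagrangian inequality
still compares it with `θs n`. In the limit the multiplier term has the favorable sign. -/
lemma mem_supportSet_of_tendsto (hΘ : IsCompact Θ)
    (hΨ : ContinuousOn (fun q : Euc d × Euc p => Ψ q.1 q.2) (Θ ×ˢ Φ)) (hφ₀ : φ₀ ∈ Φ)
    {l : Euc k} (hl : ∀ i, 0 ≤ l i) {φs : ℕ → Euc p} {θs : ℕ → Euc d} {ls : ℕ → Euc k}
    (hφs : ∀ n, φs n ∈ Φ) (hls : ∀ n, IsLagrangeMultiplier Θ Ψ ν (φs n) (ls n))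
    (hθs : ∀ n, θs n ∈ supportSet Θ Ψ ν (φs n)) (hφ : Tendsto φs atTop (𝓝 φ₀))
    (hlt : Tendsto ls atTop (𝓝 l)) (hθ : Tendsto θs atTop (𝓝 θ)) :
    θ ∈ supportSet Θ Ψ ν φ₀ := by
  have hlim : ∀ {ts : ℕ → Euc d} {t : Euc d}, (∀ n, ts n ∈ Θ) → Tendsto ts atTop (𝓝 t) →
      Tendsto (fun n => Ψ (ts n) (φs n)) atTop (𝓝 (Ψ t φ₀)) := by
    intro ts t hts ht
    have htΘ : t ∈ Θ := hΘ.isClosed.mem_of_tendsto ht (Eventually.of_forall hts)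
    have h1 := hΨ (t, φ₀) ⟨htΘ, hφ₀⟩
    exact h1.tendsto.comp (tendsto_nhdsWithin_iff.2
      ⟨ht.prodMk_nhds hφ, Eventually.of_forall fun n => ⟨hts n, hφs n⟩⟩)
  have hθΘ : θ ∈ Θ := hΘ.isClosed.mem_of_tendsto hθ (Eventually.of_forall fun n => (hθs n).1.1)
  refine ⟨⟨hθΘ, fun i => ?_⟩, fun θ' hθ' => ?_⟩
  · have h1 := hlim (fun n => (hθs n).1.1) hθ
    exact le_of_tendsto (((EuclideanSpace.proj (𝕜 := ℝ) i).continuous.tendsto _).comp h1)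
      (Eventually.of_forall fun n => (hθs n).1.2 i)
  · have h1 := hlim (fun _ => hθ'.1) tendsto_const_nhds
    have h2 : Tendsto (fun n => inner ℝ ν θ' - inner ℝ (ls n) (Ψ θ' (φs n))) atTop
        (𝓝 (inner ℝ ν θ' - inner ℝ l (Ψ θ' φ₀))) := (hlt.inner h1).const_sub _
    have h3 : Tendsto (fun n => inner ℝ ν (θs n)) atTop (𝓝 (inner ℝ ν θ)) :=
      tendsto_const_nhds.inner hθ
    have h4 := le_of_tendsto_of_tendsto' h2 h3 fun n => by
      have := (hls n).2.1 ⟨θ', hθ'.1, rfl⟩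
      rwa [supportFun_eq_inner (hθs n)] at this
    have h5 := inner_nonpos_of_nonneg_of_nonpos hl hθ'.2
    linarith

/-- The midpoint of two maximizers is optimal too, with constraint `i` slack. A positive `l i` would
lift the Lagrangian there above its supremum. -/
lemma multiplier_eq_zero_of_strictConvexOn (hconv : ∀ i, ConvexOn ℝ Θ (fun θ => Ψ θ φ i))
    {l : Euc k} (hl : IsLagrangeMultiplier Θ Ψ ν φ l) {θ₁ θ₂ : Euc d}
    (h₁ : θ₁ ∈ supportSet Θ Ψ ν φ) (h₂ : θ₂ ∈ supportSet Θ Ψ ν φ) (hne : θ₁ ≠ θ₂) {i : Fin k}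
    (hi : StrictConvexOn ℝ Θ (fun θ => Ψ θ φ i)) : l i = 0 := by
  by_contra h0
  have hpos : 0 < l i := lt_of_le_of_ne (hl.1 i) (Ne.symm h0)
  have hhalf : (0 : ℝ) < 1 / 2 := by norm_num
  have hsum : (1 / 2 : ℝ) + 1 / 2 = 1 := by norm_num
  set m : Euc d := (1 / 2 : ℝ) • θ₁ + (1 / 2 : ℝ) • θ₂ with hm
  have hmΘ : m ∈ Θ := (hconv i).1 h₁.1.1 h₂.1.1 hhalf.le hhalf.le hsum
  have hle : ∀ j, Ψ m φ j ≤ 0 := fun j => by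
    have h := (hconv j).2 h₁.1.1 h₂.1.1 hhalf.le hhalf.le hsum
    have e1 := h₁.1.2 j
    have e2 := h₂.1.2 j
    simp only [smul_eq_mul] at h
    rw [← hm] at h
    linarith
  have hlt : Ψ m φ i < 0 := by
    have h := hi.2 h₁.1.1 h₂.1.1 hne hhalf hhalf hsum
    have e1 := h₁.1.2 i
    have e2 := h₂.1.2 i
    simp only [smul_eq_mul] at h
    rw [← hm] at h
    linarith
  have hneg : inner ℝ l (Ψ m φ) < 0 := by
    rw [PiLp.inner_apply]
    refine Finset.sum_neg' (fun j _ => ?_) ⟨i, Finset.mem_univ i, ?_⟩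
    · simpa using mul_nonpos_of_nonpos_of_nonneg (hle j) (hl.1 j)
    · simpa using mul_neg_of_neg_of_pos hlt hpos
  have hub := hl.2.1 ⟨m, hmΘ, rfl⟩
  have e1 := supportFun_eq_inner h₁
  have e2 := supportFun_eq_inner h₂
  simp only [hm, inner_add_right, inner_smul_right] at hub
  rw [← hm] at hub
  linarith

lemma paramBall_mem_nhds (hφ₀ : φ₀ ∈ interior Φ) (hδ : 0 < δ) : paramBall Φ φ₀ δ ∈ 𝓝 φ₀ := by
  filter_upwards [mem_interior_iff_mem_nhds.1 hφ₀, Metric.closedBall_mem_nhds φ₀ hδ] with φ h1 h2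
  exact ⟨h1, by simpa [dist_eq_norm] using h2⟩

/-- With several maximizers, the strictly convex constraints have zero multipliers and the separable
linear ones have a `φ`-derivative independent of `θ`. -/
lemma sensitivity_eq_of_mem_supportSet (basic : BasicConditions Θ Φ Ψ φ₀)
    (hδ : 0 < δ) (regular : LocalRegularity Θ Φ Ψ φ₀ δ)
    (support : SingletonSupport Θ Φ Ψ φ₀ δ ∨ SeparableLinear Θ Φ Ψ φ₀ δ)
    (hν : ν ∈ Metric.sphere (0 : Euc d) 1) {l : Euc k} (hl : IsLagrangeMultiplier Θ Ψ ν φ₀ l)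
    {θ₁ θ₂ : Euc d} (h₁ : θ₁ ∈ supportSet Θ Ψ ν φ₀) (h₂ : θ₂ ∈ supportSet Θ Ψ ν φ₀) :
    sensitivity l (jacParam Ψ θ₁ φ₀) = sensitivity l (jacParam Ψ θ₂ φ₀) := by
  have hmem : paramBall Φ φ₀ δ ∈ 𝓝 φ₀ := paramBall_mem_nhds basic.mem_interior hδ
  have hφ₀ := mem_of_mem_nhds hmem
  rcases support with hs | ⟨L, -, hstrict, A₁, A₂, hlin⟩
  · obtain ⟨θ, hθ⟩ := hs ν hν φ₀ hφ₀
    rw [hθ] at h₁ h₂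
    rw [h₁, h₂]
  · rcases eq_or_ne θ₁ θ₂ with rfl | hne
    · rfl
    · have hcomp : ∀ θ ∈ Θ, ∀ i j, jacParam Ψ θ φ₀ i j =
          fderiv ℝ (fun φ => Ψ θ φ i) φ₀ (EuclideanSpace.single j 1) := by
        intro θ hθ i j
        have h := ((EuclideanSpace.proj (𝕜 := ℝ) i).hasFDerivAt.comp φ₀
          (regular.differentiableAt θ hθ φ₀ hφ₀).hasFDerivAt).fderiv
        have h' : (EuclideanSpace.proj (𝕜 := ℝ) i) ∘ (fun φ => Ψ θ φ) = fun φ => Ψ θ φ i := rfl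
        rw [h'] at h
        rw [h]
        rfl
      refine congrArg (WithLp.toLp 2) (funext fun j => ?_)
      simp only [Matrix.vecMul, dotProduct]
      refine Finset.sum_congr rfl fun i _ => ?_
      by_cases hi : i ∈ L
      · rw [hcomp θ₁ h₁.1.1, hcomp θ₂ h₂.1.1]
        have e : (fun φ => Ψ θ₁ φ i) =ᶠ[𝓝 φ₀]
            fun φ => Ψ θ₂ φ i + inner ℝ (A₁ ⟨i, hi⟩) (θ₁ - θ₂) := by
          filter_upwards [hmem] with φ hφ
          rw [hlin ⟨i, hi⟩ θ₁ h₁.1.1 φ hφ, hlin ⟨i, hi⟩ θ₂ h₂.1.1 φ hφ, inner_sub_right]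
          ring
        rw [e.fderiv_eq, fderiv_add_const]
      · rw [multiplier_eq_zero_of_strictConvexOn (basic.convexOn φ₀ hφ₀.1) hl h₁ h₂ hne
          (hstrict i hi), zero_mul, zero_mul]

/-- Otherwise a sequence of counterexamples has maximizers accumulating, by compactness, at a
maximizer for `φ₀`, which gives the same gradient as `θ`. Three parameters vary independently
because the envelope bound takes the multiplier at `φ₁`, the maximizer at `φ₂` and the Jacobian in
between. -/
lemma exists_norm_sensitivity_sub_le (basic : BasicConditions Θ Φ Ψ φ₀) (hδ : 0 < δ)
    (regular : LocalRegularity Θ Φ Ψ φ₀ δ)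
    (support : SingletonSupport Θ Φ Ψ φ₀ δ ∨ SeparableLinear Θ Φ Ψ φ₀ δ)
    (lam_spec : ∀ ν ∈ Metric.sphere (0 : Euc d) 1, ∀ φ ∈ paramBall Φ φ₀ δ,
      IsLagrangeMultiplier Θ Ψ ν φ (lam ν φ))
    (lipschitz : LipschitzConditions Θ Φ Ψ φ₀ lam K δ)
    (hν : ν ∈ Metric.sphere (0 : Euc d) 1) (hθ : θ ∈ supportSet Θ Ψ ν φ₀) {ε : ℝ} (hε : 0 < ε) :
    ∃ r > 0, Metric.ball φ₀ r ⊆ paramBall Φ φ₀ δ ∧ ∀ φ₁ ∈ Metric.ball φ₀ r,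
      ∀ φ₂ ∈ Metric.ball φ₀ r, ∀ φ ∈ Metric.ball φ₀ r, ∀ θ' ∈ supportSet Θ Ψ ν φ₂,
        ‖sensitivity (lam ν φ₁) (jacParam Ψ θ' φ) -
          sensitivity (lam ν φ₀) (jacParam Ψ θ φ₀)‖ ≤ ε := by
  have hmem : paramBall Φ φ₀ δ ∈ 𝓝 φ₀ := paramBall_mem_nhds basic.mem_interior hδ
  have hφ₀ := mem_of_mem_nhds hmem
  obtain ⟨r, hr, hsub⟩ := Metric.mem_nhds_iff.1 hmem
  by_contra! hcon
  have hseq : ∀ n : ℕ, ∃ (φ₁ φ₂ φ : Euc p) (θ' : Euc d),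
      φ₁ ∈ Metric.ball φ₀ (min r (1 / ((n : ℝ) + 1))) ∧
      φ₂ ∈ Metric.ball φ₀ (min r (1 / ((n : ℝ) + 1))) ∧
      φ ∈ Metric.ball φ₀ (min r (1 / ((n : ℝ) + 1))) ∧ θ' ∈ supportSet Θ Ψ ν φ₂ ∧
      ε < ‖sensitivity (lam ν φ₁) (jacParam Ψ θ' φ) -
          sensitivity (lam ν φ₀) (jacParam Ψ θ φ₀)‖ := by
    intro n
    obtain ⟨φ₁, h1, φ₂, h2, φ, h3, θ', h4, h5⟩ := hcon (min r (1 / ((n : ℝ) + 1)))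
      (lt_min hr (by positivity)) ((Metric.ball_subset_ball (min_le_left _ _)).trans hsub)
    exact ⟨φ₁, φ₂, φ, θ', h1, h2, h3, h4, h5⟩
  choose φ₁ φ₂ φ θ' h1 h2 h3 h4 h5 using hseq
  have hb : ∀ {f : ℕ → Euc p}, (∀ n : ℕ, f n ∈ Metric.ball φ₀ (min r (1 / ((n : ℝ) + 1)))) →
      (∀ n, f n ∈ paramBall Φ φ₀ δ) ∧ Tendsto f atTop (𝓝 φ₀) := by
    intro f hf
    refine ⟨fun n => hsub (Metric.ball_subset_ball (min_le_left _ _) (hf n)), ?_⟩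
    exact tendsto_iff_dist_tendsto_zero.2 (squeeze_zero (fun _ => dist_nonneg)
      (fun n => (Metric.mem_ball.1 (hf n)).le.trans (min_le_right _ _))
      tendsto_one_div_add_atTop_nhds_zero_nat)
  have hlam : ∀ {f : ℕ → Euc p}, (∀ n, f n ∈ paramBall Φ φ₀ δ) → Tendsto f atTop (𝓝 φ₀) →
      Tendsto (fun n => lam ν (f n)) atTop (𝓝 (lam ν φ₀)) := by
    intro f hf hft
    refine tendsto_iff_norm_sub_tendsto_zero.2 (squeeze_zero (fun _ => norm_nonneg _)
      (fun n => lipschitz.multiplier _ (hf n) _ hφ₀ ν hν) ?_)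
    simpa using (tendsto_iff_norm_sub_tendsto_zero.1 hft).const_mul K
  obtain ⟨t, htΘ, s, hs, hst⟩ := basic.isCompact.tendsto_subseq fun n => (h4 n).1.1
  have hsub_atTop := hs.tendsto_atTop
  obtain ⟨hm1, ht1⟩ := hb h1
  obtain ⟨hm2, ht2⟩ := hb h2
  obtain ⟨hm3, ht3⟩ := hb h3
  have htmem : t ∈ supportSet Θ Ψ ν φ₀ :=
    mem_supportSet_of_tendsto basic.isCompact basic.continuousOn hφ₀.1
      (lam_spec ν hν φ₀ hφ₀).1 (fun n => (hm2 (s n)).1)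
      (fun n => lam_spec ν hν _ (hm2 (s n))) (fun n => h4 (s n)) (ht2.comp hsub_atTop)
      ((hlam hm2 ht2).comp hsub_atTop) hst
  have hJ : Tendsto (fun n => jacParam Ψ (θ' (s n)) (φ (s n))) atTop (𝓝 (jacParam Ψ t φ₀)) :=
    (regular.continuousOn_jac (t, φ₀) ⟨htΘ, hφ₀⟩).tendsto.comp (tendsto_nhdsWithin_iff.2
      ⟨hst.prodMk_nhds (ht3.comp hsub_atTop),
        Eventually.of_forall fun n => ⟨(h4 (s n)).1.1, hm3 (s n)⟩⟩)
  have hS := (continuous_sensitivity.tendsto (lam ν φ₀, jacParam Ψ t φ₀)).comp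
    (((hlam hm1 ht1).comp hsub_atTop).prodMk_nhds hJ)
  have hS' := (hS.sub_const (sensitivity (lam ν φ₀) (jacParam Ψ θ φ₀))).norm
  simp only [sensitivity_eq_of_mem_supportSet basic hδ regular support hν
    (lam_spec ν hν φ₀ hφ₀) htmem hθ, sub_self, norm_zero] at hS'
  obtain ⟨n, hn⟩ := (hS'.eventually_lt_const hε).exists
  exact (h5 (s n)).not_gt hn

/-- The support function is strictly differentiable in `φ` at `φ₀`, with gradient
`-λᵀ ∇_φ Ψ`. -/
lemma exists_lipschitzOnWith_supportFun_add (basic : BasicConditions Θ Φ Ψ φ₀) (hδ : 0 < δ)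
    (regular : LocalRegularity Θ Φ Ψ φ₀ δ)
    (support : SingletonSupport Θ Φ Ψ φ₀ δ ∨ SeparableLinear Θ Φ Ψ φ₀ δ)
    (lam_spec : ∀ ν ∈ Metric.sphere (0 : Euc d) 1, ∀ φ ∈ paramBall Φ φ₀ δ,
      IsLagrangeMultiplier Θ Ψ ν φ (lam ν φ))
    (lipschitz : LipschitzConditions Θ Φ Ψ φ₀ lam K δ)
    (hν : ν ∈ Metric.sphere (0 : Euc d) 1) (hθ : θ ∈ supportSet Θ Ψ ν φ₀) {ε : ℝ≥0}
    (hε : 0 < ε) :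
    ∃ r > 0, LipschitzOnWith ε (fun φ => supportFun Θ Ψ φ ν +
      inner ℝ (sensitivity (lam ν φ₀) (jacParam Ψ θ φ₀)) φ) (Metric.ball φ₀ r) := by
  obtain ⟨r, hr, hsub, H⟩ := exists_norm_sensitivity_sub_le basic hδ regular support lam_spec
    lipschitz hν hθ (NNReal.coe_pos.2 hε)
  set g := sensitivity (lam ν φ₀) (jacParam Ψ θ φ₀) with hg
  have key : ∀ φ₁ ∈ Metric.ball φ₀ r, ∀ φ₂ ∈ Metric.ball φ₀ r,
      (supportFun Θ Ψ φ₂ ν + inner ℝ g φ₂) - (supportFun Θ Ψ φ₁ ν + inner ℝ g φ₁) ≤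
        ε * ‖φ₂ - φ₁‖ := by
    intro φ₁ h1 φ₂ h2
    obtain ⟨t, ht⟩ := supportSet_nonempty
      (isCompact_identifiedSet basic.isCompact basic.continuousOn (hsub h2).1)
      (regular.nonempty φ₂ (hsub h2)) ν
    have h3 := supportFun_sub_le (lam_spec ν hν φ₁ (hsub h1)) ht
    -- Mean value inequality with `t` and the multiplier frozen, comparing the derivative with `g`.
    have h4 := (convex_ball φ₀ r).norm_image_sub_le_of_norm_hasFDerivWithin_le'
      (f := fun φ => inner ℝ (lam ν φ₁) (Ψ t φ))
      (f' := fun φ => innerSL ℝ (sensitivity (lam ν φ₁) (jacParam Ψ t φ)))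
      (φ := innerSL ℝ g) (C := ε) (fun φ hφ => (hasFDerivAt_inner_multiplier
        (regular.differentiableAt t ht.1.1 φ (hsub hφ)) _).hasFDerivWithinAt)
      (fun φ hφ => by
        rw [← map_sub, innerSL_apply_norm]
        exact H φ₁ h1 φ₂ h2 φ hφ t ht) h1 h2
    have h5 := (abs_le.1 h4).1
    rw [innerSL_apply_apply, inner_sub_right] at h5
    linarith
  refine ⟨r, hr, LipschitzOnWith.of_dist_le_mul fun φ₂ h2 φ₁ h1 => ?_⟩
  rw [Real.dist_eq, dist_eq_norm]
  refine abs_le.2 ⟨?_, key φ₁ h1 φ₂ h2⟩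
  -- Exchanging the roles of multiplier and maximizer gives the lower bound.
  have := key φ₂ h2 φ₁ h1
  rw [norm_sub_rev] at this
  linarith

end SupportFunction

/-! ### Centered efficient score and tightness of `Δ_n`. -/

section Score

variable {H 𝒳 Ω : Type*} [MeasurableSpace H] [MeasurableSpace 𝒳] [MeasurableSpace Ω] {p : ℕ}

lemma memLp_and_integral_eq_zero_of_mem_span_tangentSet {P : Kernel H 𝒳} {T : Set (ℝ → H)}
    {h₀ : H} {f : 𝒳 → ℝ} (hf : f ∈ Submodule.span ℝ (tangentSet P T h₀)) [IsMarkovKernel P] :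
    MemLp f 2 (P h₀) ∧ ∫ x, f x ∂(P h₀) = 0 := by
  induction hf using Submodule.span_induction with
  | mem f hf =>
    obtain ⟨γ, -, rfl, hs⟩ := hf
    exact ⟨hs.memLp, hs.integral_eq_zero⟩
  | zero => exact ⟨MemLp.zero', by simp⟩
  | add f g _ _ hf hg =>
    refine ⟨hf.1.add hg.1, ?_⟩
    simp only [Pi.add_apply]
    rw [integral_add (hf.1.integrable one_le_two) (hg.1.integrable one_le_two), hf.2, hg.2,
      add_zero]
  | smul c f _ hf =>
    refine ⟨hf.1.const_smul c, ?_⟩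
    simp only [Pi.smul_apply]
    rw [integral_smul, hf.2, smul_zero]

/-- Scores have mean zero, and this passes to their linear span and its `L²` closure, since the `L¹`
norm is at most the `L²` norm under a probability. -/
lemma IsEfficientScore.integral_eq_zero {P : Kernel H 𝒳} [IsMarkovKernel P] {phi : H → Euc p}
    {T : Set (ℝ → H)} {h₀ : H} {l : 𝒳 → Euc p} {I₀ : Matrix (Fin p) (Fin p) ℝ}
    (h : IsEfficientScore P phi T h₀ l I₀) : ∫ x, l x ∂(P h₀) = 0 := by
  have hint : Integrable l (P h₀) := h.memLp.integrable one_le_two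
  ext j
  have hj : MemLp (fun x => l x j) 2 (P h₀) :=
    h.memLp.continuousLinearMap_comp (EuclideanSpace.proj (𝕜 := ℝ) j)
  have e : (∫ x, l x ∂(P h₀)) j = ∫ x, l x j ∂(P h₀) :=
    ((EuclideanSpace.proj (𝕜 := ℝ) j).integral_comp_comm hint).symm
  rw [e]
  refine abs_eq_zero.1 (le_antisymm (le_of_forall_pos_le_add fun ε hε => ?_) (abs_nonneg _))
  obtain ⟨f, hf, hle⟩ := h.mem_closure j ε hε
  obtain ⟨hf2, hf0⟩ := memLp_and_integral_eq_zero_of_mem_span_tangentSet hf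
  have hsub : MemLp (fun x => l x j - f x) 2 (P h₀) := hj.sub hf2
  have e1 : ∫ x, l x j ∂(P h₀) = ∫ x, (l x j - f x) ∂(P h₀) := by
    rw [integral_sub (hj.integrable one_le_two) (hf2.integrable one_le_two), hf0, sub_zero]
  rw [e1, zero_add]
  have h1 := norm_integral_le_lintegral_norm (μ := P h₀) fun x => l x j - f x
  refine h1.trans (ENNReal.toReal_le_of_le_ofReal hε.le ?_)
  refine le_trans (le_of_eq ?_) ((eLpNorm_le_eLpNorm_of_exponent_le one_le_two
    hsub.aestronglyMeasurable).trans hle)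
  rw [eLpNorm_one_eq_lintegral_enorm]
  simp only [ofReal_norm]

lemma integral_norm_sq_normalized_sum_le {Q : Measure 𝒳} [IsProbabilityMeasure Q] {ψ : 𝒳 → Euc p}
    (hψm : Measurable ψ) (hψ : MemLp ψ 2 Q) (hψ0 : ∫ x, ψ x ∂Q = 0) {μ : Measure Ω}
    [IsProbabilityMeasure μ] {X : ℕ → Ω → 𝒳} (X_meas : ∀ i, Measurable (X i))
    (X_indep : iIndepFun X μ) (X_law : ∀ i, μ.map (X i) = Q) (n : ℕ) :
    Integrable (fun ω => ‖(√n)⁻¹ • ∑ i : Fin n, ψ (X i ω)‖ ^ 2) μ ∧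
      ∫ ω, ‖(√n)⁻¹ • ∑ i : Fin n, ψ (X i ω)‖ ^ 2 ∂μ ≤ ∑ j, ∫ x, ψ x j ^ 2 ∂Q := by
  have hmp : ∀ i, MeasurePreserving (X i) μ Q := fun i => ⟨X_meas i, X_law i⟩
  have hjm : ∀ j, Measurable fun x => ψ x j := fun j => by fun_prop
  have hj : ∀ j, MemLp (fun x => ψ x j) 2 Q := fun j =>
    hψ.continuousLinearMap_comp (EuclideanSpace.proj (𝕜 := ℝ) j)
  have hj0 : ∀ j, ∫ x, ψ x j ∂Q = 0 := fun j => by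
    have := (EuclideanSpace.proj (𝕜 := ℝ) j).integral_comp_comm (hψ.integrable one_le_two)
    rw [hψ0, map_zero] at this
    exact this
  have hY : ∀ (j : Fin p) (i : Fin n), MemLp (fun ω => ψ (X i ω) j) 2 μ := fun j i =>
    (hj j).comp_measurePreserving (hmp i)
  have hY0 : ∀ (j : Fin p) (i : Fin n), ∫ ω, ψ (X i ω) j ∂μ = 0 := fun j i => by
    rw [← hj0 j, ← X_law i, integral_map (X_meas i).aemeasurable (hjm j).aestronglyMeasurable]
  have hYv : ∀ (j : Fin p) (i : Fin n), Var[fun ω => ψ (X i ω) j; μ] = ∫ x, ψ x j ^ 2 ∂Q := by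
    intro j i
    rw [variance_of_integral_eq_zero (hY j i).aestronglyMeasurable.aemeasurable (hY0 j i),
      ← X_law i, integral_map (X_meas i).aemeasurable ((hjm j).pow_const 2).aestronglyMeasurable]
  have hS : ∀ j : Fin p, MemLp (∑ i : Fin n, fun ω => ψ (X i ω) j) 2 μ := fun j =>
    memLp_finsetSum' _ fun i _ => hY j i
  have hSv : ∀ j : Fin p, ∫ ω, (∑ i : Fin n, fun ω => ψ (X i ω) j) ω ^ 2 ∂μ =
      n * ∫ x, ψ x j ^ 2 ∂Q := by
    intro j
    rw [← variance_of_integral_eq_zero (hS j).aestronglyMeasurable.aemeasurable,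
      IndepFun.variance_sum (fun i _ => hY j i), Finset.sum_congr rfl fun i _ => hYv j i]
    · simp
    · intro i _ i' _ hne
      exact (X_indep.indepFun (fun h => hne (Fin.ext h))).comp (hjm j) (hjm j)
    · simp only [Finset.sum_apply]
      rw [integral_finsetSum _ fun i _ => (hY j i).integrable one_le_two]
      simp [hY0]
  have e : (fun ω => ‖(√n)⁻¹ • ∑ i : Fin n, ψ (X i ω)‖ ^ 2) =
      fun ω => ∑ j, (n : ℝ)⁻¹ * (∑ i : Fin n, fun ω => ψ (X i ω) j) ω ^ 2 := by
    ext ω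
    rw [EuclideanSpace.real_norm_sq_eq]
    refine Finset.sum_congr rfl fun j _ => ?_
    have : (∑ i : Fin n, ψ (X i ω)) j = (∑ i : Fin n, fun ω => ψ (X i ω) j) ω := by simp
    rw [PiLp.smul_apply, this, smul_eq_mul, mul_pow, inv_pow, Real.sq_sqrt (Nat.cast_nonneg n)]
  have hint : ∀ j, Integrable
      (fun ω => (n : ℝ)⁻¹ * (∑ i : Fin n, fun ω => ψ (X i ω) j) ω ^ 2) μ := fun j =>
    (hS j).integrable_sq.const_mul _
  rw [e]
  refine ⟨integrable_finsetSum _ fun j _ => hint j, ?_⟩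
  rw [integral_finsetSum _ fun j _ => hint j]
  refine Finset.sum_le_sum fun j _ => ?_
  rw [integral_const_mul, hSv, ← mul_assoc]
  -- Only `n⁻¹ * n ≤ 1` is used, which also covers `n = 0`.
  exact mul_le_of_le_one_left (integral_nonneg fun x => sq_nonneg _) (inv_mul_le_one)

/-- The centering sequence is bounded in probability. -/
lemma exists_measureReal_lt_norm_centering_le {Q : Measure 𝒳} [IsProbabilityMeasure Q]
    {l : 𝒳 → Euc p} (I₀ : Matrix (Fin p) (Fin p) ℝ)
    (hlm : Measurable l) (hl : MemLp l 2 Q) (hl0 : ∫ x, l x ∂Q = 0) {μ : Measure Ω}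
    [IsProbabilityMeasure μ] {X : ℕ → Ω → 𝒳} (X_meas : ∀ i, Measurable (X i))
    (X_indep : iIndepFun X μ) (X_law : ∀ i, μ.map (X i) = Q) {η : ℝ} (hη : 0 < η) :
    ∃ M : ℝ, 0 ≤ M ∧ ∀ n : ℕ,
      μ.real {ω | M < ‖centering l I₀ fun i : Fin n => X i ω‖} ≤ η := by
  set A := Matrix.toEuclideanCLM (𝕜 := ℝ) (n := Fin p) I₀⁻¹ with hA
  have hψ : MemLp (fun x => A (l x)) 2 Q := hl.continuousLinearMap_comp A
  have hψ0 : ∫ x, A (l x) ∂Q = 0 := by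
    rw [A.integral_comp_comm (hl.integrable one_le_two), hl0, map_zero]
  set V := ∑ j, ∫ x, A (l x) j ^ 2 ∂Q with hV
  have hV0 : 0 ≤ V := Finset.sum_nonneg fun j _ => integral_nonneg fun x => sq_nonneg _
  -- Markov's inequality for the squared norm. The `+ 1` keeps the threshold positive when `V = 0`.
  refine ⟨√((V + 1) / η), Real.sqrt_nonneg _, fun n => ?_⟩
  obtain ⟨h1, h2⟩ := integral_norm_sq_normalized_sum_le (ψ := fun x => A (l x)) (by fun_prop) hψ
    hψ0 X_meas X_indep X_law n
  have h3 := mul_meas_ge_le_integral_of_nonneg (ae_of_all _ fun ω => sq_nonneg _) h1 ((V + 1) / η)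
  have h4 : μ.real {ω | √((V + 1) / η) < ‖centering l I₀ fun i : Fin n => X i ω‖} ≤
      μ.real {ω | (V + 1) / η ≤ ‖(√n)⁻¹ • ∑ i : Fin n, A (l (X i ω))‖ ^ 2} := by
    refine measureReal_mono fun ω hω => ?_
    exact ((Real.sqrt_lt' ((Real.sqrt_nonneg _).trans_lt hω)).1 hω).le
  refine h4.trans ?_
  have h5 := h3.trans (h2.trans (le_add_of_nonneg_right zero_le_one))
  rw [← hV, div_mul_eq_mul_div, div_le_iff₀ hη] at h5
  exact le_of_mul_le_mul_left h5 (by linarith)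

end Score

/-! ### Rescaling and the three-term error bound. -/

section DeltaMethod

open scoped NNReal

variable {H : Type*} [MeasurableSpace H] {p : ℕ}

lemma rate_pos {n : ℕ} (hn : 2 ≤ n) : 0 < rate n := by
  have h : (1 : ℝ) < n := by exact_mod_cast hn
  exact Real.sqrt_pos.2 (div_pos (Real.log_pos h) (by linarith))

lemma tendsto_rate : Tendsto rate atTop (𝓝 0) := by
  have h : Tendsto (fun n : ℕ => Real.log n / n) atTop (𝓝 0) :=
    Real.isLittleO_log_id_atTop.tendsto_div_nhds_zero.comp tendsto_natCast_atTop_atTop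
  have h' := h.sqrt
  rwa [Real.sqrt_zero] at h'

/-- Dilating the argument by `s⁻¹` and the value by `s` preserves the Lipschitz constant, so one `ε`
serves every sample size. -/
lemma lipschitzWith_rescale {R : Euc p → ℝ} {ε : ℝ≥0} (hR : LipschitzWith ε R) {s : ℝ}
    (hs : 0 < s) (φ₀ : Euc p) :
    LipschitzWith ε fun z => s * (R (φ₀ + s⁻¹ • z) - R φ₀) := by
  refine LipschitzWith.of_dist_le_mul fun x y => ?_
  have h := hR.dist_le_mul (φ₀ + s⁻¹ • x) (φ₀ + s⁻¹ • y)
  rw [dist_add_left, dist_smul₀, Real.norm_of_nonneg (by positivity), Real.dist_eq] at h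
  rw [Real.dist_eq, ← mul_sub, sub_sub_sub_cancel_right, abs_mul, abs_of_pos hs]
  calc s * |R (φ₀ + s⁻¹ • x) - R (φ₀ + s⁻¹ • y)| ≤ s * (ε * (s⁻¹ * dist x y)) := by gcongr
    _ = ε * dist x y := by field_simp

/-- The distribution of a rescaled functional `S` that is nearly linear around `φ₀` compared with
a limit `ν`: the error is the mass outside a ball, the error for the parameter itself, and
the effect of the nonlinear remainder on the limit `G`. -/
lemma tvDist_map_le_of_eqOn_ball {S : Euc p → ℝ} {g φ₀ : Euc p} {R : Euc p → ℝ}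
    (hR : Continuous R) {r s : ℝ} (hr : 0 < r)
    (hs : 0 < s) (hSR : Set.EqOn (fun φ => S φ - inner ℝ g φ) R (Metric.ball φ₀ r))
    {κ : Measure H} [IsProbabilityMeasure κ] {phi : H → Euc p} (hphi : Measurable phi)
    (hS : Measurable fun h => S (phi h)) (G : Measure (Euc p)) [IsProbabilityMeasure G]
    (ν : Measure ℝ) [IsProbabilityMeasure ν] :
    tvDist (κ.map fun h => s * (S (phi h) - S φ₀)) ν ≤
      (1 - κ.real {h | phi h ∈ Metric.ball φ₀ r}) +
        tvDist (κ.map fun h => s • (phi h - φ₀)) G +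
        tvDist (G.map fun z => inner ℝ g z + s * (R (φ₀ + s⁻¹ • z) - R φ₀)) ν := by
  set L : Euc p → ℝ := fun z => inner ℝ g z + s * (R (φ₀ + s⁻¹ • z) - R φ₀) with hL
  have hLm : Measurable L := (by fun_prop : Continuous L).measurable
  have hz : Measurable fun h => s • (phi h - φ₀) := (hphi.sub_const φ₀).const_smul s
  have hF : Measurable fun h => s * (S (phi h) - S φ₀) := (hS.sub_const _).const_mul s
  have hA : MeasurableSet {h | phi h ∈ Metric.ball φ₀ r} := hphi measurableSet_ball
  have i1 : IsProbabilityMeasure (κ.map fun h => s • (phi h - φ₀)) :=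
    Measure.isProbabilityMeasure_map hz.aemeasurable
  have i2 : IsProbabilityMeasure (κ.map fun h => s * (S (phi h) - S φ₀)) :=
    Measure.isProbabilityMeasure_map hF.aemeasurable
  have i3 : IsProbabilityMeasure ((κ.map fun h => s • (phi h - φ₀)).map L) :=
    Measure.isProbabilityMeasure_map hLm.aemeasurable
  have i4 : IsProbabilityMeasure (G.map L) := Measure.isProbabilityMeasure_map hLm.aemeasurable
  have h1 : tvDist (κ.map fun h => s * (S (phi h) - S φ₀))
      ((κ.map fun h => s • (phi h - φ₀)).map L) ≤ 1 - κ.real {h | phi h ∈ Metric.ball φ₀ r} := by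
    rw [Measure.map_map hLm hz]
    refine tvDist_map_map_le_of_eqOn κ hF (hLm.comp hz) hA fun h hh => ?_
    have e1 := hSR hh
    have e2 := hSR (Metric.mem_ball_self hr)
    simp only at e1 e2
    simp only [Function.comp, hL, smul_smul, inv_mul_cancel₀ hs.ne', one_smul,
      add_sub_cancel, ← e1, ← e2, inner_smul_right, inner_sub_right]
    ring
  have h2 := tvDist_triangle (κ.map fun h => s * (S (phi h) - S φ₀))
    ((κ.map fun h => s • (phi h - φ₀)).map L) ν
  have h3 := tvDist_triangle ((κ.map fun h => s • (phi h - φ₀)).map L) (G.map L) ν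
  have h4 := tvDist_map_le (κ.map fun h => s • (phi h - φ₀)) G hLm
  linarith

end DeltaMethod

/-! ### The Bernstein–von Mises theorem for the support function. -/

theorem mainTheorem1
    {d p k : ℕ} {H 𝒳 Ω : Type*} [MeasurableSpace H] [MeasurableSpace 𝒳] [MeasurableSpace Ω]
    -- the moment inequality model
    (Θ : Set (Euc d)) (Φ : Set (Euc p)) (Ψ : Euc d → Euc p → Euc k)
    -- the statistical model, the identified parameter, the prior, the true parameter
    (P : Kernel H 𝒳) [IsMarkovKernel P]
    (phi : H → Euc p) (phi_meas : Measurable phi) (phi_mem : ∀ h, phi h ∈ Φ)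
    (pr : Measure H) [IsProbabilityMeasure pr] (h₀ : H)
    -- the i.i.d. data and the posteriors
    (μ : Measure Ω) [IsProbabilityMeasure μ] (X : ℕ → Ω → 𝒳) (X_meas : ∀ i, Measurable (X i))
    (X_indep : iIndepFun X μ) (X_law : ∀ i, μ.map (X i) = P h₀)
    (post : ∀ n, Kernel (Fin n → 𝒳) H) (post_spec : ∀ n, IsPosterior pr P n (post n))
    -- conditions on the model, with radius `√(log n / n)`
    (basic : BasicConditions Θ Φ Ψ (phi h₀)) (N : ℕ)
    (regular : ∀ n ≥ N, LocalRegularity Θ Φ Ψ (phi h₀) (rate n))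
    (support : ∀ n ≥ N, SingletonSupport Θ Φ Ψ (phi h₀) (rate n) ∨
      SeparableLinear Θ Φ Ψ (phi h₀) (rate n))
    (lam : Euc d → Euc p → Euc k)
    (lam_spec : ∀ n ≥ N, ∀ ν ∈ Metric.sphere (0 : Euc d) 1, ∀ φ ∈ paramBall Φ (phi h₀) (rate n),
      IsLagrangeMultiplier Θ Ψ ν φ (lam ν φ))
    (K : ℝ) (K_pos : 0 < K)
    (lipschitz : ∀ n ≥ N, LipschitzConditions Θ Φ Ψ (phi h₀) lam K (rate n))
    (supportSet_cond : SupportSetCondition Θ Φ Ψ (phi h₀) rate N)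
    -- concentration of the posterior of `φ`
    (C : ℝ) (C_pos : 0 < C)
    (concentration : TendstoInMeasure μ
      (fun (n : ℕ) ω => (post n fun i => X i ω).real {h | ‖phi h - phi h₀‖ ≤ C * rate n})
      atTop (fun _ => (1 : ℝ)))
    -- Bernstein–von Mises theorem for `φ`
    (T : Set (ℝ → H)) (l : 𝒳 → Euc p) (I₀ : Matrix (Fin p) (Fin p) ℝ)
    (efficient : IsEfficientScore P phi T h₀ l I₀)
    (bvm : TendstoInMeasure μ
      (fun (n : ℕ) ω => tvDist
        ((post n fun i => X i ω).map fun h => √n • (phi h - phi h₀))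
        (multivariateGaussian (centering l I₀ fun i : Fin n => X i ω) I₀⁻¹))
      atTop (fun _ => (0 : ℝ)))
    -- a selection of the support set at the true value
    (θstar : Euc d → Euc d)
    (θstar_mem : ∀ ν ∈ Metric.sphere (0 : Euc d) 1, θstar ν ∈ supportSet Θ Ψ ν (phi h₀)) :
    ∀ ν ∈ Metric.sphere (0 : Euc d) 1,
      0 < invQuadForm I₀ (sensitivity (lam ν (phi h₀)) (jacParam Ψ (θstar ν) (phi h₀))) →
      TendstoInMeasure μ
        (fun (n : ℕ) ω => tvDist
          ((post n fun i => X i ω).map fun h =>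
            √n * (supportFun Θ Ψ (phi h) ν - supportFun Θ Ψ (phi h₀) ν))
          (gaussianReal
            (-inner ℝ (sensitivity (lam ν (phi h₀)) (jacParam Ψ (θstar ν) (phi h₀)))
              (centering l I₀ fun i : Fin n => X i ω))
            (invQuadForm I₀
              (sensitivity (lam ν (phi h₀)) (jacParam Ψ (θstar ν) (phi h₀)))).toNNReal))
        atTop (fun _ => (0 : ℝ)) := by
  intro ν hν hpos
  set φ₀ := phi h₀ with hφ₀
  set v := sensitivity (lam ν φ₀) (jacParam Ψ (θstar ν) φ₀) with hv
  -- The local conditions are needed at a single positive radius; `rate` vanishes at `0` and `1`.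
  set n₀ := max N 2 with hn₀
  have hδ : 0 < rate n₀ := rate_pos (le_max_right _ _)
  have hN : N ≤ n₀ := le_max_left _ _
  have hS : Measurable fun h => supportFun Θ Ψ (phi h) ν :=
    (measurable_supportFun basic.isCompact basic.continuousOn ν).comp
      (phi_meas.subtype_mk (h := phi_mem))
  have hpsd : I₀⁻¹.PosSemidef := efficient.posDef.inv.posSemidef
  have hg : (-v : Euc p) ⬝ᵥ I₀⁻¹.mulVec (-v : Euc p) = invQuadForm I₀ v := by
    simp [invQuadForm, Matrix.mulVec_neg]
  rw [tendstoInMeasure_iff_measureReal_dist] at concentration bvm ⊢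
  intro e he
  have he4 : 0 < e / 4 := by positivity
  have hc := concentration (e / 4) he4
  have hb := bvm (e / 4) he4
  refine tendsto_order.2 ⟨fun a ha => Eventually.of_forall fun n =>
    ha.trans_le measureReal_nonneg, fun a ha => ?_⟩
  -- `M`, then `ε`, then `r` are chosen, all independent of `n`. Three errors of `e / 4` stay below
  -- `e`, and the probability `a` is shared between large `Δ_n` and the failure of the two posterior
  -- limits.
  obtain ⟨M, hM, hMn⟩ := exists_measureReal_lt_norm_centering_le I₀ efficient.measurable
    efficient.memLp efficient.integral_eq_zero X_meas X_indep X_law (half_pos ha)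
  obtain ⟨ε, hε, hG⟩ := exists_tvDist_map_multivariateGaussian_le hpsd (g := -v)
    (by rw [hg]; exact hpos) hM he4
  obtain ⟨r, hr, hlip⟩ := exists_lipschitzOnWith_supportFun_add basic hδ (regular n₀ hN)
    (support n₀ hN) (lam_spec n₀ hN) (lipschitz n₀ hN) hν (θstar_mem ν hν) hε
  -- The remainder must be Lipschitz on the whole space, because the Gaussian limit is not confined
  -- to the ball.
  obtain ⟨R, hR, hSR⟩ := hlip.extend_real
  have hrate : ∀ᶠ n in atTop, C * rate n < r := by
    have h := tendsto_rate.const_mul C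
    rw [mul_zero] at h
    exact h.eventually_lt_const hr
  have hsum := hc.add hb
  rw [add_zero] at hsum
  filter_upwards [hrate, hsum.eventually_lt_const (half_pos ha), eventually_gt_atTop 0]
    with n hn1 hn2 hn3
  have hs : 0 < √(n : ℝ) := Real.sqrt_pos.2 (Nat.cast_pos.2 hn3)
  have : IsMarkovKernel (post n) := (post_spec n).1
  refine lt_of_le_of_lt (measureReal_mono
    (s₂ := {ω | M < ‖centering l I₀ fun i : Fin n => X i ω‖} ∪
      ({ω | e / 4 ≤ dist ((post n fun i => X i ω).real {h | ‖phi h - φ₀‖ ≤ C * rate n}) 1} ∪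
        {ω | e / 4 ≤ dist (tvDist ((post n fun i => X i ω).map fun h => √n • (phi h - φ₀))
          (multivariateGaussian (centering l I₀ fun i : Fin n => X i ω) I₀⁻¹)) 0}))
    fun ω hω => ?_) (?_ : _ < a)
  · by_contra hcon
    simp only [Set.mem_union, Set.mem_ofPred_eq, not_or, not_le, not_lt] at hcon hω
    obtain ⟨k1, k2, k3⟩ := hcon
    rw [Real.dist_eq, sub_zero, abs_of_nonneg (tvDist_nonneg _ _)] at k3 hω
    rw [Real.dist_eq] at k2
    have k4 := hG _ k1 _ (lipschitzWith_rescale hR hs φ₀) (by simp)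
    rw [hg, inner_neg_left] at k4
    have k5 := tvDist_map_le_of_eqOn_ball (S := fun φ => supportFun Θ Ψ φ ν) (g := -v)
      hR.continuous hr hs (fun φ hφ => by
        rw [← hSR hφ]
        simp [hv]) (κ := post n fun i => X i ω) phi_meas hS
      (multivariateGaussian (centering l I₀ fun i : Fin n => X i ω) I₀⁻¹)
      (gaussianReal (-inner ℝ v (centering l I₀ fun i : Fin n => X i ω))
        (invQuadForm I₀ v).toNNReal)
    have k6 : (post n fun i => X i ω).real {h | ‖phi h - φ₀‖ ≤ C * rate n} ≤
        (post n fun i => X i ω).real {h | phi h ∈ Metric.ball φ₀ r} := by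
      refine measureReal_mono fun h hh => ?_
      rw [Set.mem_ofPred_eq, mem_ball_iff_norm]
      exact lt_of_le_of_lt hh hn1
    have k7 := (abs_lt.1 k2).1
    linarith
  · refine (measureReal_union_le _ _).trans_lt ?_
    have h1 := hMn n
    have h2 := measureReal_union_le (μ := μ)
      {ω | e / 4 ≤ dist ((post n fun i => X i ω).real {h | ‖phi h - φ₀‖ ≤ C * rate n}) 1}
      {ω | e / 4 ≤ dist (tvDist ((post n fun i => X i ω).map fun h => √n • (phi h - φ₀))
          (multivariateGaussian (centering l I₀ fun i : Fin n => X i ω) I₀⁻¹)) 0}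
    linarith
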